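/- Consider episodic Markov decision processes with $S\ge 2$ states, $A\ge 2$ actions, horizon $H\ge 2$, a fixed initial state $s_1$, a known reward function $r_h(s,a)\in[0,1]$ and unknown transition probabilities $P_h(\cdot\mid s,a)$, $1\le h\le H$. A (possibly randomized) multi-batch algorithm with $M$ batches fixes, before learning starts, batch lengths $t_1,\dots,t_M$ with $\sum_m t_m=K$; before batch $m$ it chooses a stochastic Markov policy $\pi^m$ based on the trajectories of the earlier batches only (and on its internal randomness), and follows $\pi^m$ for the $t_m$ episodes of the batch. Its regret is $\mathrm{Regret}(K)=\sum_{k=1}^K\bigl(V_1^*(s_1)-V_1^{\pi^{(k)}}(s_1)\bigr)$, where $\pi^{(k)}$ is the policy of episode $k$. **Theorem.** Let $0<\delta<\tfrac12$ and $\varepsilon>0$. There is a constant $c>0$, depending only on $\delta$ and $\varepsilon$, such that for all $C\in\mathbb R$ and $p\in\mathbb N$ there is a $B\in\mathbb N$ (depending only on $\delta,\varepsilon,C,p$) with the following property. Let $S,A,H\ge 2$ and $K$, and let an algorithm with $M$ batches satisfy the bound $\mathrm{Regret}(K)\le C\,(SAH)^p\sqrt K$ in every MDP with these parameters and initial state $s_1$,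 either with probability at least $1-\delta$ in every such MDP, or in expectation in every such MDP. Then 1. if $K\ge (B\,SAH)^B$, then $M\ge c\,\dfrac{H}{\log_A K}$; 2. if $\ln K\ge B\,\bigl(\ln (SAH)\bigr)^{1+\varepsilon}$, then $M\ge c\left(\dfrac{H}{\log_A K}+\log_2\log_2 K\right)$. That is, any algorithm with $O(\mathrm{poly}(S,A,H)\sqrt K)$ regret needs $\Omega\bigl(H/\log_A K+\log_2\log_2 K\bigr)$ batches. -/

import Mathlib

open MeasureTheory Finset

universe u

noncomputable section

/-! Finite-horizon episodic MDPs with state set `Fin S`, action set `Fin A` and horizon `H`.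
The steps `1, …, H` are indexed by `Fin H`, that is, by `0, …, H - 1`. -/

/-- A (deterministic) reward function `r_h(s,a) ∈ [0,1]`. -/
abbrev Reward (S A H : ℕ) : Type := Fin H → Fin S → Fin A → unitInterval

/-- A transition model: `P h s a` is the law of the next state. -/
abbrev Transition (S A H : ℕ) : Type := Fin H → Fin S → Fin A → stdSimplex ℝ (Fin S)

/-- A stochastic policy: `π h s` is the law of the action taken in state `s` at step `h`. -/
abbrev Policy (S A H : ℕ) : Type := Fin H → Fin S → stdSimplex ℝ (Fin A)

/-- The trajectory of one episode, recorded as `h ↦ (a_h, s_{h+1})`; the initial state is fixed. -/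
abbrev Trajectory (S A H : ℕ) : Type := Fin H → Fin A × Fin S

variable {S A H K M : ℕ}

/-- The state `s_h` of a trajectory that starts at `s₁`. -/
def Trajectory.state (s₁ : Fin S) (τ : Trajectory S A H) (h : Fin H) : Fin S :=
  if h.val = 0 then s₁ else (τ ⟨h.val - 1, lt_of_le_of_lt (Nat.sub_le _ _) h.isLt⟩).2

/-- The total reward `∑_h r_h(s_h, a_h)` of a trajectory. -/
def Trajectory.totalReward (s₁ : Fin S) (r : Reward S A H) (τ : Trajectory S A H) : ℝ :=
  ∑ h, (r h (τ.state s₁ h) (τ h).1 : ℝ)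

/-- The probability of a trajectory when policy `π` is followed in the transition model `P`. -/
def trajProb (s₁ : Fin S) (P : Transition S A H) (π : Policy S A H) (τ : Trajectory S A H) : ℝ :=
  ∏ h, ((π h (τ.state s₁ h)).1 (τ h).1 * (P h (τ.state s₁ h) (τ h).1).1 (τ h).2)

/-- `V₁^π(s₁)`: the expected total reward of `π`. -/
def value (s₁ : Fin S) (r : Reward S A H) (P : Transition S A H) (π : Policy S A H) : ℝ :=
  ∑ τ : Trajectory S A H, trajProb s₁ P π τ * τ.totalReward s₁ r

/-- `V₁^*(s₁)`: the optimal value. -/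
def optValue (s₁ : Fin S) (r : Reward S A H) (P : Transition S A H) : ℝ :=
  ⨆ π : Policy S A H, value s₁ r P π

/-- A (randomized) multi-batch learning algorithm with `K` episodes and `M` batches.
The internal randomness is a seed `ω` drawn before the learning process from an arbitrary
probability space.  The batch lengths are determined before the learning process (they see
no data, though they may depend on the seed); empty batches are allowed.  The policy of batch `m`
is a function of the seed and of the list of trajectories observed in all earlier batches. -/
structure BatchAlgorithm (S A H K M : ℕ) where
  Seed : Type u
  [measurableSpace : MeasurableSpace Seed]
  law : Measure Seed
  [isProbabilityMeasure : IsProbabilityMeasure law]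
  len : Fin M → Seed → ℕ
  measurable_len : ∀ m, Measurable (len m)
  sum_len : ∀ ω, ∑ m, len m ω = K
  policy : Fin M → Seed → List (Trajectory S A H) → Policy S A H
  measurable_policy : ∀ m l, Measurable (fun ω => policy m ω l)

attribute [instance] BatchAlgorithm.measurableSpace BatchAlgorithm.isProbabilityMeasure

namespace BatchAlgorithm

/-- The number of episodes that precede batch `m`. -/
def start (alg : BatchAlgorithm.{u} S A H K M) (m : Fin M) (ω : alg.Seed) : ℕ :=
  ∑ j ∈ Finset.univ.filter (fun j : Fin M => j < m), alg.len j ω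

/-- The set of episodes of batch `m`. -/
def batch (alg : BatchAlgorithm.{u} S A H K M) (m : Fin M) (ω : alg.Seed) : Finset (Fin K) :=
  Finset.univ.filter
    (fun k : Fin K => alg.start m ω ≤ k.val ∧ k.val < alg.start m ω + alg.len m ω)

/-- The policy followed throughout batch `m`, when `D k` is the trajectory of episode `k`; only the
episodes of the earlier batches are looked at. -/
def batchPolicy (alg : BatchAlgorithm.{u} S A H K M) (m : Fin M) (ω : alg.Seed)
    (D : Fin K → Trajectory S A H) : Policy S A H :=
  alg.policy m ω ((List.ofFn D).take (alg.start m ω))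

/-- The conditional probability, given the seed, that the `K` trajectories are `D`, when the
algorithm is run in the transition model `P`. -/
def dataProb (alg : BatchAlgorithm.{u} S A H K M) (s₁ : Fin S) (P : Transition S A H)
    (ω : alg.Seed) (D : Fin K → Trajectory S A H) : ℝ :=
  ∏ m, ∏ k ∈ alg.batch m ω, trajProb s₁ P (alg.batchPolicy m ω D) (D k)

/-- The regret `∑_k (V₁^*(s₁) - V₁^{π^{(k)}}(s₁))`, with the sum over episodes grouped by batch. -/
def regret (alg : BatchAlgorithm.{u} S A H K M) (s₁ : Fin S) (r : Reward S A H)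
    (P : Transition S A H) (ω : alg.Seed) (D : Fin K → Trajectory S A H) : ℝ :=
  ∑ m, ∑ _k ∈ alg.batch m ω, (optValue s₁ r P - value s₁ r P (alg.batchPolicy m ω D))

/-- The expected regret. -/
def expectedRegret (alg : BatchAlgorithm.{u} S A H K M) (s₁ : Fin S) (r : Reward S A H)
    (P : Transition S A H) : ℝ :=
  ∫ ω, ∑ D, alg.dataProb s₁ P ω D * alg.regret s₁ r P ω D ∂alg.law

open Classical in
/-- The probability that the regret is at most `b`. -/
def probRegretLE (alg : BatchAlgorithm.{u} S A H K M) (s₁ : Fin S) (r : Reward S A H)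
    (P : Transition S A H) (b : ℝ) : ℝ :=
  ∫ ω, ∑ D, alg.dataProb s₁ P ω D * (if alg.regret s₁ r P ω D ≤ b then 1 else 0) ∂alg.law

end BatchAlgorithm

end

/-! Each summand has its own family of hard instances, in which the reward is 1 for being in `s₁` at
one step. That reward does not depend on the unknown transitions, so knowing it reveals nothing. All
estimates are made for a fixed seed, hence for a fixed grid of batches, and integrated over the seed
at the end. A bound in expectation becomes one with probability `1 - δ` by Markov's inequality.

Horizon term: in a combination lock, `s₁` is kept only by playing a secret action at every step. Let
batch `m` (counted from 0) be run in the lock truncated at step `(m + 1) L`. Its policy is then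
independent of the secrets of block `m`, so over a uniform secret it guesses that block with
probability `A ^ (-L)`. The true lock produces the same trajectories unless some episode survives
its block. With `A ^ L` of order `K`, a union bound over episodes excludes this with probability at
least 1/2, while the regret is linear in `K`. Hence `H ≤ M * L` (`trajProb_lockModel_le`,
`sum_expectedGuess`, `sum_dataProb_lockModel_le`, `horizon_le_of_probRegretLE`).

Iterated logarithm: a two-armed bandit is embedded in the first step. Fewer than `u` episodes cannot
tell the parameters `1/2 ± d` apart when `d` is a small multiple of `1 / √u`, so a batch that starts
before `u` and has length far above `β * √u` is too costly for one of the two signs. The end of some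
batch must therefore typically fall in each level `[u j, u (j + 1))`, where `u (j + 1) = G * √K *
√(u j)`. Such a sequence has about `log₂ log₂ K` terms below `K` when `log G` is at most a power of
`log K` with exponent below 1 (`seqSum_reweight_le`, `banditSuccess_add_le`,
`levels_le_of_probRegretLE`, `exists_levels`). -/

section SequentialSampling

/-! ### Sums over adaptively drawn histories and change of measure -/

variable {T : Type*} [Fintype T]

/-- The weighted sum of `f` over the histories reached from the history `l` by `n` further draws,
where `g l x` is the weight of drawing `x` after the history `l`. -/
noncomputable def seqSum (g : List T → T → ℝ) : ℕ → (List T → ℝ) → List T → ℝ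
  | 0, f, l => f l
  | n + 1, f, l => ∑ x, g l x * seqSum g n f (l ++ [x])

theorem seqSum_eq_sum (g : List T → T → ℝ) (n : ℕ) (f : List T → ℝ) (l : List T) :
    seqSum g n f l = ∑ D : Fin n → T,
      (∏ k : Fin n, g (l ++ (List.ofFn D).take k) (D k)) * f (l ++ List.ofFn D) := by
  induction n generalizing l with
  | zero => simp [seqSum]
  | succ n ih =>
    rw [← (Fin.consEquiv (fun _ => T)).sum_comp, Fintype.sum_prod_type]
    simp only [seqSum]
    refine Finset.sum_congr rfl fun x _ => ?_
    rw [ih, Finset.mul_sum]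
    refine Finset.sum_congr rfl fun D _ => ?_
    simp [Fin.consEquiv, Fin.prod_univ_succ, List.ofFn_succ, mul_assoc]

theorem seqSum_mono {g : List T → T → ℝ} (hg : ∀ l x, 0 ≤ g l x) {n : ℕ} {f f' : List T → ℝ}
    {l : List T} (h : ∀ r : List T, r.length = n → f (l ++ r) ≤ f' (l ++ r)) :
    seqSum g n f l ≤ seqSum g n f' l := by
  induction n generalizing l with
  | zero => simpa [seqSum] using h [] rfl
  | succ n ih =>
    refine Finset.sum_le_sum fun x _ => mul_le_mul_of_nonneg_left (ih fun r hr => ?_) (hg l x)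
    simpa using h (x :: r) (by simp [hr])

theorem seqSum_congr {g : List T → T → ℝ} {n : ℕ} {f f' : List T → ℝ}
    {l : List T} (h : ∀ r : List T, r.length = n → f (l ++ r) = f' (l ++ r)) :
    seqSum g n f l = seqSum g n f' l := by
  induction n generalizing l with
  | zero => simpa [seqSum] using h [] rfl
  | succ n ih =>
    refine Finset.sum_congr rfl fun x _ => ?_
    rw [ih fun r hr => ?_]
    simpa using h (x :: r) (by simp [hr])

theorem seqSum_congr_kernel {g g' : List T → T → ℝ} {N n : ℕ} {f : List T → ℝ} {l : List T}
    (h : ∀ l' : List T, l'.length < N → g l' = g' l') (hl : l.length + n ≤ N) :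
    seqSum g n f l = seqSum g' n f l := by
  induction n generalizing l with
  | zero => rfl
  | succ n ih =>
    refine Finset.sum_congr rfl fun x _ => ?_
    rw [ih (by simp; omega), h l (by omega)]

theorem seqSum_fun_add (g : List T → T → ℝ) (n : ℕ) (f f' : List T → ℝ) (l : List T) :
    seqSum g n (fun l => f l + f' l) l = seqSum g n f l + seqSum g n f' l := by
  simp only [seqSum_eq_sum, mul_add, Finset.sum_add_distrib]

theorem seqSum_const_mul (g : List T → T → ℝ) (n : ℕ) (c : ℝ) (f : List T → ℝ) (l : List T) :
    seqSum g n (fun l => c * f l) l = c * seqSum g n f l := by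
  simp only [seqSum_eq_sum, Finset.mul_sum]
  exact Finset.sum_congr rfl fun _ _ => by ring

theorem seqSum_sum {ι : Type*} (g : List T → T → ℝ) (n : ℕ) (s : Finset ι) (f : ι → List T → ℝ)
    (l : List T) : seqSum g n (fun l => ∑ i ∈ s, f i l) l = ∑ i ∈ s, seqSum g n (f i) l := by
  simp only [seqSum_eq_sum, Finset.mul_sum]
  exact Finset.sum_comm

theorem seqSum_const {g : List T → T → ℝ} (hg : ∀ l, ∑ x, g l x = 1) (n : ℕ) (c : ℝ)
    (l : List T) : seqSum g n (fun _ => c) l = c := by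
  induction n generalizing l with
  | zero => rfl
  | succ n ih => simp only [seqSum, ih, ← Finset.sum_mul, hg, one_mul]

theorem seqSum_steps_add (g : List T → T → ℝ) (m n : ℕ) (f : List T → ℝ) (l : List T) :
    seqSum g (m + n) f l = seqSum g m (seqSum g n f) l := by
  induction m generalizing l with
  | zero => simp [seqSum]
  | succ m ih => simp only [Nat.succ_add, seqSum, ih]

/-- The draws after the first `t` have total weight 1 and do not influence `f`, so they integrate
out. -/
theorem seqSum_of_take {g : List T → T → ℝ} (hg : ∀ l, ∑ x, g l x = 1) {t n : ℕ} (htn : t ≤ n)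
    {f : List T → ℝ} (hf : ∀ l, f (l.take t) = f l) : seqSum g n f [] = seqSum g t f [] := by
  obtain ⟨d, rfl⟩ := Nat.exists_eq_add_of_le htn
  rw [seqSum_steps_add]
  refine seqSum_congr fun r hr => ?_
  rw [List.nil_append]
  trans seqSum g d (fun _ => f r) r
  · refine seqSum_congr fun r' _ => ?_
    rw [← hf (r ++ r'), ← hr, List.take_left']
    rfl
  · exact seqSum_const hg _ _ _

/-- A product of per-draw ratios can be absorbed into the kernel one draw at a time. With `ρ` this
yields the changed law, with `ρ ^ 2` the second moment of the likelihood ratio. -/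
theorem seqSum_reweight (g : List T → T → ℝ) (ρ : T → ℝ) (n : ℕ) (f : List T → ℝ) (l : List T) :
    seqSum g n (fun l => (l.map ρ).prod * f l) l =
      (l.map ρ).prod * seqSum (fun l x => g l x * ρ x) n f l := by
  induction n generalizing l with
  | zero => rfl
  | succ n ih =>
    simp only [seqSum, ih, Finset.mul_sum]
    refine Finset.sum_congr rfl fun x _ => ?_
    simp only [List.map_append, List.prod_append, List.map_cons, List.map_nil, List.prod_singleton]
    ring

theorem seqSum_one_le_pow {g : List T → T → ℝ} (hg : ∀ l x, 0 ≤ g l x) {c : ℝ} (hc : 0 ≤ c)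
    (h : ∀ l, ∑ x, g l x ≤ c) (n : ℕ) (l : List T) : seqSum g n (fun _ => 1) l ≤ c ^ n := by
  induction n generalizing l with
  | zero => simp [seqSum]
  | succ n ih =>
    calc seqSum g (n + 1) (fun _ => 1) l ≤ ∑ x, g l x * c ^ n :=
          Finset.sum_le_sum fun x _ => mul_le_mul_of_nonneg_left (ih _) (hg l x)
      _ = (∑ x, g l x) * c ^ n := by rw [Finset.sum_mul]
      _ ≤ c * c ^ n := mul_le_mul_of_nonneg_right (h l) (by positivity)
      _ = c ^ (n + 1) := by ring

/-- A change of measure with likelihood ratio `ρ` per draw changes the expectation of a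
`[0,1]`-valued function by at most `η`, when the second moment of the total likelihood ratio is at
most `1 + η²`. -/
theorem seqSum_reweight_le {g : List T → T → ℝ} (hg : ∀ l x, 0 ≤ g l x)
    (hg1 : ∀ l, ∑ x, g l x = 1) {ρ : T → ℝ}
    (hρ1 : ∀ l, ∑ x, g l x * ρ x = 1) {c : ℝ} (hc : 0 ≤ c) (hρ2 : ∀ l, ∑ x, g l x * ρ x ^ 2 ≤ c)
    {f : List T → ℝ} (hf0 : ∀ l, 0 ≤ f l) (hf1 : ∀ l, f l ≤ 1) {η : ℝ} (hη : 0 < η) {n : ℕ}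
    (hcn : c ^ n ≤ 1 + η ^ 2) :
    seqSum (fun l x => g l x * ρ x) n f [] ≤ seqSum g n f [] + η := by
  have e1 : seqSum g n (fun l => (l.map ρ).prod * f l) [] =
      seqSum (fun l x => g l x * ρ x) n f [] := by simp [seqSum_reweight]
  have e2 : seqSum g n (fun l => (l.map ρ).prod) [] = 1 := by
    have := seqSum_reweight g ρ n (fun _ => 1) []
    simpa [seqSum_const hρ1] using this
  have e3 : seqSum g n (fun l => (l.map ρ).prod ^ 2) [] ≤ c ^ n := by
    have := seqSum_reweight g (fun x => ρ x ^ 2) n (fun _ => 1) []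
    simp only [List.map_nil, List.prod_nil, mul_one, one_mul] at this
    have hp : ∀ l : List T, (l.map fun x => ρ x ^ 2).prod = (l.map ρ).prod ^ 2 := by
      intro l
      induction l with
      | nil => simp
      | cons x l ih => simp [ih, mul_pow]
    simp only [hp] at this
    rw [this]
    exact seqSum_one_le_pow (fun l x => mul_nonneg (hg l x) (sq_nonneg _)) hc hρ2 n []
  have key : seqSum g n (fun l => (l.map ρ).prod * f l) [] ≤
      seqSum g n (fun l => f l + ((1 / (2 * η)) * (l.map ρ).prod ^ 2 +
        ((-(1 / η)) * (l.map ρ).prod + (1 / (2 * η) + η / 2)))) [] := by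
    refine seqSum_mono hg fun r _ => ?_
    rw [List.nil_append]
    set x := (r.map ρ).prod
    -- The right side is `(x - 1) ^ 2 / (2 * η) + η / 2`. This replaces Cauchy–Schwarz by a bound
    -- linear in the moments of `x`; its mean is at most `η` when that of `x ^ 2` is at most `1 + η
    -- ^ 2`.
    have h1 : |x - 1| ≤ (1 / (2 * η)) * x ^ 2 + ((-(1 / η)) * x + (1 / (2 * η) + η / 2)) := by
      have : (1 / (2 * η)) * x ^ 2 + ((-(1 / η)) * x + (1 / (2 * η) + η / 2)) - |x - 1| =
          (|x - 1| - η) ^ 2 / (2 * η) := by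
        field_simp
        have := sq_abs (x - 1)
        nlinarith
      have h2 : 0 ≤ (|x - 1| - η) ^ 2 / (2 * η) := by positivity
      linarith
    have h3 : (x - 1) * f r ≤ |x - 1| := by
      calc (x - 1) * f r ≤ |x - 1| * f r := mul_le_mul_of_nonneg_right (le_abs_self _) (hf0 r)
        _ ≤ |x - 1| * 1 := mul_le_mul_of_nonneg_left (hf1 r) (abs_nonneg _)
        _ = _ := mul_one _
    linarith
  rw [seqSum_fun_add, seqSum_fun_add, seqSum_fun_add, seqSum_const_mul, seqSum_const_mul, e1, e2,
    seqSum_const hg1] at key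
  have h4 : (1 / (2 * η)) * seqSum g n (fun l => (l.map ρ).prod ^ 2) [] ≤
      (1 / (2 * η)) * (1 + η ^ 2) := mul_le_mul_of_nonneg_left (e3.trans hcn) (by positivity)
  have h5 : (1 / (2 * η)) * (1 + η ^ 2) + (-(1 / η) * 1 + (1 / (2 * η) + η / 2)) = η := by
    field_simp
    ring
  linarith

end SequentialSampling

/-! ### Laws of trajectories and values of policies -/

section Trajectories

theorem trajProb_nonneg (s₁ : Fin S) (P : Transition S A H) (π : Policy S A H)
    (τ : Trajectory S A H) : 0 ≤ trajProb s₁ P π τ :=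
  Finset.prod_nonneg fun h _ => mul_nonneg ((π h _).2.1 _) ((P h _ _).2.1 _)

theorem Trajectory.state_zero {n : ℕ} (s : Fin S) (τ : Trajectory S A (n + 1)) :
    Trajectory.state s τ 0 = s := by
  simp [Trajectory.state]

theorem Trajectory.state_succ {n : ℕ} (s : Fin S) (τ : Trajectory S A (n + 1)) (h : Fin n) :
    Trajectory.state s τ h.succ = (τ h.castSucc).2 := by
  simp [Trajectory.state]
  rfl

theorem Trajectory.state_cons_succ {n : ℕ} (s : Fin S) (x : Fin A × Fin S)
    (τ : Trajectory S A n) (h : Fin n) :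
    Trajectory.state s (Fin.cons x τ : Trajectory S A (n + 1)) h.succ =
      Trajectory.state x.2 τ h := by
  cases n with
  | zero => exact h.elim0
  | succ n =>
    rw [Trajectory.state_succ]
    refine Fin.cases ?_ (fun i => ?_) h
    · simp [Trajectory.state_zero]
    · rw [Trajectory.state_succ, Fin.castSucc_succ, Fin.cons_succ]

theorem trajProb_cons {n : ℕ} (s : Fin S) (P : Transition S A (n + 1)) (π : Policy S A (n + 1))
    (x : Fin A × Fin S) (τ : Trajectory S A n) :
    trajProb s P π (Fin.cons x τ : Trajectory S A (n + 1)) =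
      ((π 0 s).1 x.1 * (P 0 s x.1).1 x.2) *
        trajProb x.2 (fun h => P h.succ) (fun h => π h.succ) τ := by
  simp only [trajProb]
  rw [Fin.prod_univ_succ]
  simp only [Trajectory.state_zero, Trajectory.state_cons_succ, Fin.cons_zero, Fin.cons_succ]

theorem sum_trajProb_mul_cons {n : ℕ} (s : Fin S) (P : Transition S A (n + 1))
    (π : Policy S A (n + 1)) (F : Trajectory S A (n + 1) → ℝ) :
    ∑ τ, trajProb s P π τ * F τ = ∑ x : Fin A × Fin S, ((π 0 s).1 x.1 * (P 0 s x.1).1 x.2) *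
      ∑ τ : Trajectory S A n, trajProb x.2 (fun h => P h.succ) (fun h => π h.succ) τ *
        F (Fin.cons x τ : Trajectory S A (n + 1)) := by
  rw [← (Fin.consEquiv (fun _ => Fin A × Fin S)).sum_comp, Fintype.sum_prod_type]
  refine Finset.sum_congr rfl fun x _ => ?_
  rw [Finset.mul_sum]
  refine Finset.sum_congr rfl fun τ _ => ?_
  rw [← mul_assoc, ← trajProb_cons]
  rfl

theorem sum_trajProb (s : Fin S) (P : Transition S A H) (π : Policy S A H) :
    ∑ τ, trajProb s P π τ = 1 := by
  induction H generalizing s with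
  | zero => simp [trajProb]
  | succ n ih =>
    have := sum_trajProb_mul_cons s P π (fun _ => 1)
    simp only [mul_one, ih] at this
    rw [this, Fintype.sum_prod_type]
    simp only [← Finset.mul_sum, (P 0 s _).2.2, mul_one, (π 0 s).2.2]

theorem sum_trajProb_first {n : ℕ} (s : Fin S) (P : Transition S A (n + 1))
    (π : Policy S A (n + 1)) (F : Fin A × Fin S → ℝ) :
    ∑ τ, trajProb s P π τ * F (τ 0) =
      ∑ a, (π 0 s).1 a * ∑ t, (P 0 s a).1 t * F (a, t) := by
  rw [sum_trajProb_mul_cons, Fintype.sum_prod_type]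
  simp only [Fin.cons_zero, ← Finset.sum_mul, sum_trajProb, one_mul, mul_assoc, Finset.mul_sum]

/-- If, before step `n`, the state `s₁` can be reached only from `s₁` and by the secret action,
then the state `s₁` is occupied at step `n` only if all the earlier actions are the secret ones. -/
theorem sum_trajProb_state_eq (s₁ s : Fin S) (P : Transition S A H) (π : Policy S A H)
    (a : Fin H → Fin A) (n : Fin H)
    (hP : ∀ h < n, ∀ s a', (P h s a').1 s₁ = if s = s₁ ∧ a' = a h then 1 else 0) :
    ∑ τ, trajProb s P π τ * (if Trajectory.state s τ n = s₁ then 1 else 0) =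
      if s = s₁ then ∏ h, (if h < n then (π h s₁).1 (a h) else 1) else 0 := by
  induction H generalizing s with
  | zero => exact n.elim0
  | succ k ih =>
    refine Fin.cases (fun hP => ?_) (fun m hP => ?_) n hP
    · simp [Trajectory.state_zero, sum_trajProb]
    · rw [sum_trajProb_mul_cons]
      simp only [Trajectory.state_cons_succ]
      have ih' := fun s => ih s (fun h => P h.succ) (fun h => π h.succ) (fun h => a h.succ) m
        (fun h hh => hP h.succ (Fin.succ_lt_succ_iff.2 hh))
      simp only [ih']
      simp only [Fintype.sum_prod_type, mul_ite, mul_zero, Finset.sum_ite_eq',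
        Finset.mem_univ, if_true, hP 0 (Fin.succ_pos m)]
      by_cases hs : s = s₁
      · subst hs
        simp [Fin.prod_univ_succ]
      · simp [hs]

theorem Trajectory.totalReward_nonneg (s₁ : Fin S) (r : Reward S A H) (τ : Trajectory S A H) :
    0 ≤ τ.totalReward s₁ r :=
  Finset.sum_nonneg fun h _ => (r h _ _).2.1

theorem Trajectory.totalReward_le (s₁ : Fin S) (r : Reward S A H) (τ : Trajectory S A H) :
    τ.totalReward s₁ r ≤ H := by
  refine (Finset.sum_le_sum fun h _ => (r h _ _).2.2).trans ?_
  simp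

theorem value_nonneg (s₁ : Fin S) (r : Reward S A H) (P : Transition S A H) (π : Policy S A H) :
    0 ≤ value s₁ r P π :=
  Finset.sum_nonneg fun τ _ => mul_nonneg (trajProb_nonneg _ _ _ _) (τ.totalReward_nonneg _ _)

theorem value_le (s₁ : Fin S) (r : Reward S A H) (P : Transition S A H) (π : Policy S A H) :
    value s₁ r P π ≤ H := by
  calc value s₁ r P π ≤ ∑ τ, trajProb s₁ P π τ * H := Finset.sum_le_sum fun τ _ =>
        mul_le_mul_of_nonneg_left (τ.totalReward_le _ _) (trajProb_nonneg _ _ _ _)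
    _ = H := by rw [← Finset.sum_mul, sum_trajProb, one_mul]

theorem value_le_optValue (s₁ : Fin S) (r : Reward S A H) (P : Transition S A H)
    (π : Policy S A H) : value s₁ r P π ≤ optValue s₁ r P :=
  le_ciSup (f := fun π => value s₁ r P π)
    ⟨H, by rintro _ ⟨π, rfl⟩; exact value_le s₁ r P π⟩ π

theorem optValue_le (s₁ : Fin S) (r : Reward S A H) (P : Transition S A H) :
    optValue s₁ r P ≤ H :=
  Real.iSup_le (fun π => value_le s₁ r P π) (Nat.cast_nonneg _)

/-- The point mass at `i`. -/
noncomputable def pointMass {k : ℕ} (i : Fin k) : stdSimplex ℝ (Fin k) :=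
  ⟨Pi.single i 1, single_mem_stdSimplex ℝ i⟩

/-- The open-loop policy that takes the action `f h` at step `h`. -/
noncomputable def openLoop (f : Fin H → Fin A) : Policy S A H := fun h _ => pointMass (f h)

/-- The reward `1` for occupying the state `s₁` at step `n`. -/
noncomputable def stepReward (s₁ : Fin S) (n : Fin H) : Reward S A H :=
  fun h s _ => if h = n ∧ s = s₁ then 1 else 0

theorem value_stepReward (s₁ : Fin S) (n : Fin H) (P : Transition S A H) (π : Policy S A H) :
    value s₁ (stepReward s₁ n) P π =
      ∑ τ, trajProb s₁ P π τ * (if τ.state s₁ n = s₁ then 1 else 0) := by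
  refine Finset.sum_congr rfl fun τ _ => ?_
  congr 1
  have : ∀ h, ((stepReward s₁ n h (τ.state s₁ h) (τ h).1 : unitInterval) : ℝ) =
      if h = n then (if τ.state s₁ n = s₁ then 1 else 0) else 0 := by
    intro h
    by_cases hn : h = n
    · subst hn
      by_cases hs : τ.state s₁ h = s₁ <;> simp [stepReward, hs]
    · simp [stepReward, hn]
  simp [Trajectory.totalReward, this]

end Trajectories

/-! ### The combination lock -/

section CombinationLock

/-- The combination lock with secret `a`, truncated at step `n`: the state `s₁` is kept by playing
the secret action in it before step `n`; otherwise the next state is `b`. -/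
noncomputable def lockModel (s₁ b : Fin S) (a : Fin H → Fin A) (n : ℕ) : Transition S A H :=
  fun h s a' => if s = s₁ ∧ a' = a h ∧ h.val < n then pointMass s₁ else pointMass b

theorem lockModel_apply {s₁ b : Fin S} (hb : b ≠ s₁) (a : Fin H → Fin A) {n : ℕ} {h : Fin H}
    (hn : h.val < n) (s : Fin S) (a' : Fin A) :
    (lockModel s₁ b a n h s a').1 s₁ = if s = s₁ ∧ a' = a h then 1 else 0 := by
  by_cases hs : s = s₁ ∧ a' = a h
  · simp [lockModel, hs, hn, pointMass]
  · rw [lockModel, if_neg (fun h' => hs ⟨h'.1, h'.2.1⟩), if_neg hs]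
    simp [pointMass, hb.symm]

theorem lockModel_congr (s₁ b : Fin S) {a a' : Fin H → Fin A} {n : ℕ}
    (h : ∀ i : Fin H, i.val < n → a i = a' i) : lockModel s₁ b a n = lockModel s₁ b a' n := by
  funext i s x
  by_cases hi : i.val < n
  · simp [lockModel, h i hi]
  · simp [lockModel, hi]

theorem sum_trajProb_lockModel {s₁ b : Fin S} (hb : b ≠ s₁) (a : Fin H → Fin A) {N : ℕ}
    (n : Fin H) (hn : n.val ≤ N) (π : Policy S A H) :
    ∑ τ, trajProb s₁ (lockModel s₁ b a N) π τ * (if τ.state s₁ n = s₁ then 1 else 0) =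
      ∏ h, (if h < n then (π h s₁).1 (a h) else 1) := by
  rw [sum_trajProb_state_eq s₁ s₁ _ π a n fun h hh s a' => lockModel_apply hb a (by omega) s a']
  simp

/-- Truncation is invisible on a trajectory that has left `s₁` by step `n`. Before `n` the two
models agree; from `n` on, the truncated one only permits moves to `b`, and outside `s₁` the longer
lock makes the same moves. -/
theorem trajProb_lockModel_le {s₁ b : Fin S} (hb : b ≠ s₁) (a : Fin H → Fin A) {N : ℕ}
    (n : Fin H) (hn : n.val ≤ N) (π : Policy S A H) (τ : Trajectory S A H) :
    (if τ.state s₁ n = s₁ then 0 else trajProb s₁ (lockModel s₁ b a n) π τ) ≤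
      trajProb s₁ (lockModel s₁ b a N) π τ := by
  split_ifs with h0
  · exact trajProb_nonneg _ _ _ _
  by_cases hex : ∃ h ≥ n, (τ h).2 ≠ b
  · obtain ⟨h, hh, hτ⟩ := hex
    have : trajProb s₁ (lockModel s₁ b a n) π τ = 0 := by
      refine Finset.prod_eq_zero (Finset.mem_univ h) ?_
      have hlt : ¬ h.val < n.val := by simpa using hh
      simp [lockModel, hlt, pointMass, hτ]
    rw [this]
    exact trajProb_nonneg _ _ _ _
  · push Not at hex
    refine le_of_eq (Finset.prod_congr rfl fun h _ => ?_)
    congr 2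
    by_cases hh : h.val < n.val
    · have : h.val < N := by omega
      simp [lockModel, hh, this]
    · have hst : τ.state s₁ h ≠ s₁ := by
        by_cases hhn : h = n
        · rwa [hhn]
        · have h1 : h.val ≠ n.val := fun h' => hhn (Fin.ext h')
          have h2 : h.val ≠ 0 := by omega
          rw [Trajectory.state, if_neg h2, hex _ (Fin.le_def.2 (by simp; omega))]
          exact hb
      simp [lockModel, hst]

theorem value_lockModel {s₁ b : Fin S} (hb : b ≠ s₁) (a : Fin H → Fin A) (n : Fin H)
    (π : Policy S A H) : value s₁ (stepReward s₁ n) (lockModel s₁ b a H) π =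
      ∏ h, (if h < n then (π h s₁).1 (a h) else 1) := by
  rw [value_stepReward, sum_trajProb_lockModel hb a n n.isLt.le]

theorem one_le_optValue_lockModel {s₁ b : Fin S} (hb : b ≠ s₁) (a : Fin H → Fin A) (n : Fin H) :
    1 ≤ optValue s₁ (stepReward s₁ n) (lockModel s₁ b a H) := by
  refine le_trans (le_of_eq ?_) (value_le_optValue _ _ _ (openLoop a))
  rw [value_lockModel hb]
  simp [openLoop, pointMass]

end CombinationLock

/-! ### A bandit in the first step -/

section Bandit

/-- The two-point law that gives mass `x` to `s` and mass `1 - x` to `b`. -/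
noncomputable def twoPoint (s b : Fin S) (x : unitInterval) : stdSimplex ℝ (Fin S) :=
  ⟨fun t => (if t = s then (x : ℝ) else 0) + (if t = b then 1 - (x : ℝ) else 0), fun t => by
    have h0 := x.2.1
    have h1 := x.2.2
    dsimp only
    split_ifs <;> linarith, by simp [Finset.sum_add_distrib]⟩

theorem sum_twoPoint (s b : Fin S) (x : unitInterval) (F : Fin S → ℝ) :
    ∑ t, (twoPoint s b x).1 t * F t = x * F s + (1 - x) * F b := by
  simp [twoPoint, add_mul, Finset.sum_add_distrib]

/-- The fair parameter. -/
noncomputable def fairParam : unitInterval := ⟨1 / 2, by norm_num, by norm_num⟩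

/-- A bandit: at the first step, the action `a₁` leads to `s₁` with probability `x`; everything
else leads to `s₁` with probability `1/2`. -/
noncomputable def banditModel (s₁ b : Fin S) (a₁ : Fin A) (x : unitInterval) :
    Transition S A (H + 2) :=
  fun h _ a => if h = 0 ∧ a = a₁ then twoPoint s₁ b x else twoPoint s₁ b fairParam

/-- The likelihood ratio of the bandits with parameter `x` and with the fair parameter. -/
noncomputable def banditRatio (s₁ : Fin S) (a₁ : Fin A) (x : unitInterval)
    (y : Fin A × Fin S) : ℝ :=
  if y.1 = a₁ then (if y.2 = s₁ then 2 * x else 2 * (1 - x)) else 1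

theorem trajProb_banditModel {s₁ b : Fin S} (hb : b ≠ s₁) (a₁ : Fin A) (x : unitInterval)
    (π : Policy S A (H + 2)) (τ : Trajectory S A (H + 2)) :
    trajProb s₁ (banditModel s₁ b a₁ x) π τ =
      trajProb s₁ (banditModel s₁ b a₁ fairParam) π τ * banditRatio s₁ a₁ x (τ 0) := by
  simp only [trajProb]
  rw [Fin.prod_univ_succ, Fin.prod_univ_succ (n := H + 1)]
  simp only [Trajectory.state_zero, banditModel, Fin.succ_ne_zero, false_and, if_false, true_and,
    ite_self]
  have key : (if (τ 0).1 = a₁ then twoPoint s₁ b x else twoPoint s₁ b fairParam).1 (τ 0).2 =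
      (twoPoint s₁ b fairParam).1 (τ 0).2 * banditRatio s₁ a₁ x (τ 0) := by
    by_cases ha : (τ 0).1 = a₁
    · by_cases hs : (τ 0).2 = s₁
      · simp [ha, hs, banditRatio, twoPoint, hb.symm, fairParam]
      · by_cases hs' : (τ 0).2 = b
        · simp [ha, hs', hb, banditRatio, twoPoint, fairParam]
          ring
        · simp [ha, hs', hs, banditRatio, twoPoint]
    · simp [ha, banditRatio]
  rw [key]
  ring

/-- Only the arm `a₁` carries information, and there the second moment is `2 x² + 2 (1 - x)² = 1 + 4
(x - 1/2)²`; the other arms contribute 1. -/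
theorem sum_trajProb_banditRatio_sq {s₁ b : Fin S} (hb : b ≠ s₁) (a₁ : Fin A) (x : unitInterval)
    (π : Policy S A (H + 2)) :
    ∑ τ, trajProb s₁ (banditModel s₁ b a₁ fairParam) π τ * banditRatio s₁ a₁ x (τ 0) ^ 2 ≤
      1 + 4 * ((x : ℝ) - 1 / 2) ^ 2 := by
  rw [sum_trajProb_first s₁ _ π fun y => banditRatio s₁ a₁ x y ^ 2]
  calc _ ≤ ∑ a, (π 0 s₁).1 a * (1 + 4 * ((x : ℝ) - 1 / 2) ^ 2) := by
        refine Finset.sum_le_sum fun a _ => mul_le_mul_of_nonneg_left ?_ ((π 0 s₁).2.1 a)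
        simp only [banditModel, ite_self, sum_twoPoint]
        by_cases ha : a = a₁
        · simp only [fairParam, banditRatio, ha, if_true, hb, if_false]
          nlinarith
        · simp only [fairParam, banditRatio, ha, if_false]
          nlinarith [sq_nonneg ((x : ℝ) - 1 / 2)]
    _ = _ := by rw [← Finset.sum_mul, (π 0 s₁).2.2, one_mul]

theorem value_banditModel {s₁ b : Fin S} (hb : b ≠ s₁) (a₁ : Fin A) (x : unitInterval)
    (π : Policy S A (H + 2)) :
    value s₁ (stepReward s₁ 1) (banditModel s₁ b a₁ x) π =
      1 / 2 + ((x : ℝ) - 1 / 2) * (π 0 s₁).1 a₁ := by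
  rw [value_stepReward]
  have : ∀ τ : Trajectory S A (H + 2), τ.state s₁ 1 = (τ 0).2 := fun τ =>
    Trajectory.state_succ s₁ τ 0
  simp only [this]
  rw [sum_trajProb_first s₁ _ π fun y => if y.2 = s₁ then 1 else 0]
  have h2 : ∀ a, ∑ t, (banditModel (H := H) s₁ b a₁ x 0 s₁ a).1 t *
      (if t = s₁ then (1 : ℝ) else 0) = 1 / 2 + if a = a₁ then (x : ℝ) - 1 / 2 else 0 := by
    intro a
    by_cases ha : a = a₁
    · simp [banditModel, ha, twoPoint, hb.symm]
    · simp [banditModel, ha, twoPoint, hb.symm, fairParam]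
  simp only [h2]
  simp only [mul_add, Finset.sum_add_distrib, ← Finset.sum_mul, (π 0 s₁).2.2, mul_ite,
    mul_zero, Finset.sum_ite_eq', Finset.mem_univ, if_true]
  ring

theorem le_optValue_banditModel {s₁ b : Fin S} (hb : b ≠ s₁) (a₁ a₂ : Fin A) (x : unitInterval) :
    1 / 2 + (if a₂ = a₁ then (x : ℝ) - 1 / 2 else 0) ≤
      optValue s₁ (stepReward s₁ 1) (banditModel (H := H) s₁ b a₁ x) := by
  refine le_trans (le_of_eq ?_) (value_le_optValue _ _ _ (openLoop fun _ => a₂))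
  rw [value_banditModel hb]
  by_cases h : a₂ = a₁
  · simp [openLoop, pointMass, h]
  · simp [openLoop, pointMass, h, Ne.symm h]

end Bandit

namespace BatchAlgorithm

/-! ### The grid of batches and the episode-by-episode form of the algorithm -/

section Grid

variable (alg : BatchAlgorithm.{u} S A H K M) (ω : alg.Seed)

/-- The partial sums of the batch lengths go from 0 to `K`; the first one that reaches `x` ends the
required batch. Minimality makes the first inequality strict even if there are empty batches. -/
theorem exists_first_batch {x : ℝ} (hx : 0 < x) (hxK : x ≤ K) :
    ∃ m, (alg.start m ω : ℝ) < x ∧ x ≤ ((alg.start m ω + alg.len m ω : ℕ) : ℝ) := by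
  classical
  set c : ℕ → ℕ := fun i => ∑ j ∈ Finset.univ.filter (fun j : Fin M => j.val < i), alg.len j ω
    with hc
  have hex : ∃ i, x ≤ c i := ⟨M, by simpa [hc, alg.sum_len ω] using hxK⟩
  have hmin : ∀ i < Nat.find hex, (c i : ℝ) < x := fun i hi => not_le.1 (Nat.find_min hex hi)
  have hspec := Nat.find_spec hex
  have hle : Nat.find hex ≤ M := Nat.find_min' hex (by simpa [hc, alg.sum_len ω] using hxK)
  generalize Nat.find hex = i at hmin hspec hle
  cases i with
  | zero => simp [hc] at hspec; linarith
  | succ i =>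
    have hadd : c (i + 1) = alg.start ⟨i, hle⟩ ω + alg.len ⟨i, hle⟩ ω := by
      have : Finset.univ.filter (fun j : Fin M => j.val < i + 1) =
          insert ⟨i, hle⟩ (Finset.univ.filter (fun j : Fin M => j < ⟨i, hle⟩)) := by
        ext j
        simp [Fin.lt_def, Fin.ext_iff]
        omega
      simp only [hc, this]
      rw [Finset.sum_insert (by simp), add_comm]
      rfl
    exact ⟨⟨i, hle⟩, hmin i (Nat.lt_succ_self i), hadd ▸ hspec⟩

theorem start_add_len_le_start {m m' : Fin M} (h : m < m') :
    alg.start m ω + alg.len m ω ≤ alg.start m' ω := by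
  rw [start, start, add_comm, ← Finset.sum_insert (f := fun j => alg.len j ω) (a := m) (by simp)]
  refine Finset.sum_le_sum_of_subset fun j hj => ?_
  rcases Finset.mem_insert.1 hj with rfl | hj
  · simpa using h
  · simpa using (Finset.mem_filter.1 hj).2.trans h

theorem start_add_len_le (m : Fin M) : alg.start m ω + alg.len m ω ≤ K := by
  rw [start, add_comm, ← Finset.sum_insert (f := fun j => alg.len j ω) (a := m) (by simp)]
  exact (Finset.sum_le_sum_of_subset (Finset.subset_univ _)).trans_eq (alg.sum_len ω)

theorem card_batch (m : Fin M) : (alg.batch m ω).card = alg.len m ω := by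
  have h : (alg.batch m ω).map Fin.valEmbedding =
      Finset.Ico (alg.start m ω) (alg.start m ω + alg.len m ω) := by
    ext k
    have := alg.start_add_len_le ω m
    simp only [batch, Finset.mem_map, Finset.mem_filter, Finset.mem_univ, true_and,
      Fin.valEmbedding_apply, Finset.mem_Ico]
    exact ⟨by rintro ⟨i, hi, rfl⟩; exact hi, fun hk => ⟨⟨k, by omega⟩, hk, rfl⟩⟩
  rw [← Finset.card_map Fin.valEmbedding, h]
  simp

theorem batches_pos (alg : BatchAlgorithm.{u} S A H K M) (hK : 0 < K) : 0 < M := by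
  obtain ⟨ω⟩ := nonempty_of_isProbabilityMeasure alg.law
  by_contra h
  obtain rfl : M = 0 := by omega
  simpa [hK.ne] using alg.sum_len ω

variable [NeZero M]

open Classical in
/-- The batch of episode `k` (and a default value if there is none). -/
noncomputable def batchOf (k : ℕ) : Fin M :=
  if h : ∃ m, alg.start m ω ≤ k ∧ k < alg.start m ω + alg.len m ω then h.choose else 0

theorem batchOf_eq {m : Fin M} {k : ℕ} (h1 : alg.start m ω ≤ k)
    (h2 : k < alg.start m ω + alg.len m ω) : alg.batchOf ω k = m := by
  have hex : ∃ m, alg.start m ω ≤ k ∧ k < alg.start m ω + alg.len m ω := ⟨m, h1, h2⟩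
  rw [batchOf, dif_pos hex]
  obtain ⟨h3, h4⟩ := hex.choose_spec
  rcases lt_trichotomy hex.choose m with h | h | h
  · have := alg.start_add_len_le_start ω h
    omega
  · exact h
  · have := alg.start_add_len_le_start ω h
    omega

theorem batchOf_spec {k : ℕ} (hk : k < K) : alg.start (alg.batchOf ω k) ω ≤ k ∧
    k < alg.start (alg.batchOf ω k) ω + alg.len (alg.batchOf ω k) ω := by
  obtain ⟨m, h1, h2⟩ := alg.exists_first_batch ω (x := (k + 1 : ℕ)) (by positivity)
    (by exact_mod_cast hk)
  have h1' : alg.start m ω ≤ k := Nat.lt_succ_iff.1 (by exact_mod_cast h1)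
  have h2' : k < alg.start m ω + alg.len m ω := by exact_mod_cast h2
  rw [alg.batchOf_eq ω h1' h2']
  exact ⟨h1', h2'⟩

theorem mem_batch_iff (k : Fin K) (m : Fin M) : k ∈ alg.batch m ω ↔ alg.batchOf ω k = m := by
  rw [batch, Finset.mem_filter]
  refine ⟨fun h => alg.batchOf_eq ω h.2.1 h.2.2, ?_⟩
  rintro rfl
  exact ⟨Finset.mem_univ _, alg.batchOf_spec ω k.isLt⟩

/-- The policy followed in the episode after the history `l`. -/
noncomputable def histPolicy (l : List (Trajectory S A H)) : Policy S A H :=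
  alg.policy (alg.batchOf ω l.length) ω (l.take (alg.start (alg.batchOf ω l.length) ω))

theorem histPolicy_take (D : Fin K → Trajectory S A H) (k : Fin K) :
    alg.histPolicy ω ((List.ofFn D).take k) = alg.batchPolicy (alg.batchOf ω k) ω D := by
  have h1 : ((List.ofFn D).take k).length = k := by simp
  rw [histPolicy, h1, List.take_take, min_eq_left (alg.batchOf_spec ω k.isLt).1]
  rfl

theorem prod_batch (F : Fin M → Fin K → ℝ) :
    ∏ m, ∏ k ∈ alg.batch m ω, F m k = ∏ k : Fin K, F (alg.batchOf ω k) k := by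
  rw [← Finset.prod_fiberwise Finset.univ (fun k : Fin K => alg.batchOf ω k)]
  refine Finset.prod_congr rfl fun m _ => ?_
  have : alg.batch m ω = Finset.univ.filter fun k : Fin K => alg.batchOf ω k = m := by
    ext k
    simp [mem_batch_iff]
  rw [this]
  refine Finset.prod_congr rfl fun k hk => ?_
  rw [(Finset.mem_filter.1 hk).2]

theorem sum_batch (F : Fin M → Fin K → ℝ) :
    ∑ m, ∑ k ∈ alg.batch m ω, F m k = ∑ k : Fin K, F (alg.batchOf ω k) k := by
  rw [← Finset.sum_fiberwise Finset.univ (fun k : Fin K => alg.batchOf ω k)]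
  refine Finset.sum_congr rfl fun m _ => ?_
  have : alg.batch m ω = Finset.univ.filter fun k : Fin K => alg.batchOf ω k = m := by
    ext k
    simp [mem_batch_iff]
  rw [this]
  refine Finset.sum_congr rfl fun k hk => ?_
  rw [(Finset.mem_filter.1 hk).2]

/-- The law of the next trajectory after the history `l`. -/
noncomputable def kernel (s₁ : Fin S) (P : Transition S A H) (l : List (Trajectory S A H))
    (τ : Trajectory S A H) : ℝ :=
  trajProb s₁ P (alg.histPolicy ω l) τ

theorem kernel_nonneg (s₁ : Fin S) (P : Transition S A H) (l : List (Trajectory S A H))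
    (τ : Trajectory S A H) : 0 ≤ alg.kernel ω s₁ P l τ :=
  trajProb_nonneg _ _ _ _

/-- This also holds for histories of length `K` or more, where `batchOf` takes its default value, so
that the normalization hypotheses on `seqSum` need no length restriction. -/
theorem sum_kernel (s₁ : Fin S) (P : Transition S A H) (l : List (Trajectory S A H)) :
    ∑ τ, alg.kernel ω s₁ P l τ = 1 :=
  sum_trajProb _ _ _

theorem dataProb_eq_prod (s₁ : Fin S) (P : Transition S A H) (D : Fin K → Trajectory S A H) :
    alg.dataProb s₁ P ω D = ∏ k : Fin K, alg.kernel ω s₁ P ((List.ofFn D).take k) (D k) := by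
  rw [dataProb, prod_batch]
  simp only [kernel, histPolicy_take]

theorem sum_dataProb_mul (s₁ : Fin S) (P : Transition S A H)
    (f : List (Trajectory S A H) → ℝ) :
    ∑ D, alg.dataProb s₁ P ω D * f (List.ofFn D) = seqSum (alg.kernel ω s₁ P) K f [] := by
  rw [seqSum_eq_sum]
  simp only [List.nil_append, dataProb_eq_prod]

theorem sum_dataProb (s₁ : Fin S) (P : Transition S A H) :
    ∑ D, alg.dataProb s₁ P ω D = 1 := by
  have := alg.sum_dataProb_mul ω s₁ P fun _ => 1
  rw [seqSum_const (alg.sum_kernel ω s₁ P)] at this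
  simpa using this

theorem regret_eq_sum (s₁ : Fin S) (r : Reward S A H) (P : Transition S A H)
    (D : Fin K → Trajectory S A H) : alg.regret s₁ r P ω D =
      ∑ k : Fin K, (optValue s₁ r P -
        value s₁ r P (alg.histPolicy ω ((List.ofFn D).take k))) := by
  rw [regret, sum_batch]
  simp only [histPolicy_take]

end Grid

/-! ### Bounds and measurability of the regret, and Markov's inequality -/

section Regret

variable (alg : BatchAlgorithm.{u} S A H K M) (s₁ : Fin S) (r : Reward S A H)
  (P : Transition S A H)

theorem dataProb_nonneg (ω : alg.Seed) (D : Fin K → Trajectory S A H) :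
    0 ≤ alg.dataProb s₁ P ω D :=
  Finset.prod_nonneg fun _ _ => Finset.prod_nonneg fun _ _ => trajProb_nonneg _ _ _ _

theorem batch_regret_le_regret (ω : alg.Seed) (D : Fin K → Trajectory S A H) (m : Fin M) :
    alg.len m ω * (optValue s₁ r P - value s₁ r P (alg.batchPolicy m ω D)) ≤
      alg.regret s₁ r P ω D := by
  have h : ∀ m, 0 ≤ ∑ _k ∈ alg.batch m ω,
      (optValue s₁ r P - value s₁ r P (alg.batchPolicy m ω D)) := fun m =>
    Finset.sum_nonneg fun _ _ => sub_nonneg.2 (value_le_optValue _ _ _ _)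
  refine le_trans (le_of_eq ?_) (Finset.single_le_sum (fun m _ => h m) (Finset.mem_univ m))
  rw [Finset.sum_const, card_batch, nsmul_eq_mul]

theorem regret_nonneg (ω : alg.Seed) (D : Fin K → Trajectory S A H) :
    0 ≤ alg.regret s₁ r P ω D :=
  Finset.sum_nonneg fun _ _ => Finset.sum_nonneg fun _ _ =>
    sub_nonneg.2 (value_le_optValue _ _ _ _)

theorem regret_le (ω : alg.Seed) (D : Fin K → Trajectory S A H) :
    alg.regret s₁ r P ω D ≤ K * H := by
  calc alg.regret s₁ r P ω D ≤ ∑ m, ∑ _k ∈ alg.batch m ω, (H : ℝ) :=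
        Finset.sum_le_sum fun m _ => Finset.sum_le_sum fun _ _ => by
          have := value_nonneg s₁ r P (alg.batchPolicy m ω D)
          have := optValue_le s₁ r P
          linarith
    _ = (∑ m, (alg.len m ω : ℝ)) * H := by
        simp only [Finset.sum_const, card_batch, nsmul_eq_mul, Finset.sum_mul]
    _ = K * H := by
        rw [← Nat.cast_sum, alg.sum_len]

theorem measurable_start (m : Fin M) : Measurable (alg.start m) :=
  Finset.measurable_sum _ fun j _ => alg.measurable_len j

/-- The seed enters both through the policy and through the number of observed episodes; the latter
is countably valued, so measurability for each fixed number suffices. -/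
theorem measurable_batchPolicy (m : Fin M) (D : Fin K → Trajectory S A H) :
    Measurable fun ω => alg.batchPolicy m ω D := by
  have h : Measurable fun q : ℕ × alg.Seed => alg.policy m q.2 ((List.ofFn D).take q.1) :=
    measurable_from_prod_countable_right fun n =>
      alg.measurable_policy m ((List.ofFn D).take n)
  exact h.comp ((alg.measurable_start m).prodMk measurable_id)

theorem measurable_trajProb (τ : Trajectory S A H) :
    Measurable fun π : Policy S A H => trajProb s₁ P π τ := by
  refine Finset.measurable_prod _ fun h _ => Measurable.mul_const ?_ _
  exact (measurable_pi_apply (τ h).1).comp (measurable_subtype_coe.comp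
    ((measurable_pi_apply (τ.state s₁ h)).comp (measurable_pi_apply h)))

theorem measurable_value : Measurable fun π : Policy S A H => value s₁ r P π :=
  Finset.measurable_sum _ fun τ _ => (measurable_trajProb s₁ P τ).mul_const _

theorem measurableSet_mem_batch (m : Fin M) (k : Fin K) :
    MeasurableSet {ω | k ∈ alg.batch m ω} := by
  have : {ω | k ∈ alg.batch m ω} =
      {ω | alg.start m ω ≤ k} ∩ {ω | k.val < alg.start m ω + alg.len m ω} := by
    ext ω
    simp [batch]
  rw [this]
  exact (measurableSet_le (alg.measurable_start m) measurable_const).inter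
    (measurableSet_lt measurable_const ((alg.measurable_start m).add (alg.measurable_len m)))

theorem measurable_dataProb (D : Fin K → Trajectory S A H) :
    Measurable fun ω => alg.dataProb s₁ P ω D := by
  classical
  have : (fun ω => alg.dataProb s₁ P ω D) = fun ω => ∏ m, ∏ k : Fin K,
      if k ∈ alg.batch m ω then trajProb s₁ P (alg.batchPolicy m ω D) (D k) else 1 := by
    funext ω
    refine Finset.prod_congr rfl fun m _ => ?_
    rw [← Finset.prod_filter]
    exact Finset.prod_congr (by ext; simp) fun _ _ => rfl
  rw [this]
  exact Finset.measurable_prod _ fun m _ => Finset.measurable_prod _ fun k _ =>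
    Measurable.ite (alg.measurableSet_mem_batch m k)
      ((measurable_trajProb s₁ P (D k)).comp (alg.measurable_batchPolicy m D)) measurable_const

theorem measurable_regret (D : Fin K → Trajectory S A H) :
    Measurable fun ω => alg.regret s₁ r P ω D := by
  have : (fun ω => alg.regret s₁ r P ω D) = fun ω => ∑ m, (alg.len m ω : ℝ) *
      (optValue s₁ r P - value s₁ r P (alg.batchPolicy m ω D)) := by
    funext ω
    refine Finset.sum_congr rfl fun m _ => ?_
    rw [Finset.sum_const, card_batch, nsmul_eq_mul]
  rw [this]
  exact Finset.measurable_sum _ fun m _ =>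
    ((measurable_from_top (f := fun n : ℕ => (n : ℝ))).comp (alg.measurable_len m)).mul
      (measurable_const.sub ((measurable_value s₁ r P).comp (alg.measurable_batchPolicy m D)))

theorem integrable_of_measurable_bounded {f : alg.Seed → ℝ} (hf : Measurable f) {c : ℝ}
    (h0 : ∀ ω, 0 ≤ f ω) (hc : ∀ ω, f ω ≤ c) : Integrable f alg.law :=
  Integrable.of_bound hf.aestronglyMeasurable c (Filter.Eventually.of_forall fun ω => by
    rw [Real.norm_of_nonneg (h0 ω)]
    exact hc ω)

/-- Markov's inequality for the regret. -/
theorem one_sub_le_probRegretLE (hK : 0 < K) {b δ : ℝ} (hδ : 0 < δ) (hb : 0 < b)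
    (h : alg.expectedRegret s₁ r P ≤ b) : 1 - δ ≤ alg.probRegretLE s₁ r P (b / δ) := by
  classical
  have : NeZero M := ⟨(alg.batches_pos hK).ne'⟩
  have hc : 0 < b / δ := div_pos hb hδ
  have hi1 : Integrable (fun ω => ∑ D, alg.dataProb s₁ P ω D * alg.regret s₁ r P ω D) alg.law := by
    refine alg.integrable_of_measurable_bounded (c := K * H)
      (Finset.measurable_sum _ fun D _ =>
        (alg.measurable_dataProb s₁ P D).mul (alg.measurable_regret s₁ r P D))
      (fun ω => Finset.sum_nonneg fun D _ =>
        mul_nonneg (alg.dataProb_nonneg s₁ P ω D) (alg.regret_nonneg s₁ r P ω D)) fun ω => ?_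
    refine (Finset.sum_le_sum fun D _ => mul_le_mul_of_nonneg_left (alg.regret_le s₁ r P ω D)
      (alg.dataProb_nonneg s₁ P ω D)).trans ?_
    rw [← Finset.sum_mul, sum_dataProb, one_mul]
  have hi2 : Integrable (fun ω => ∑ D, alg.dataProb s₁ P ω D *
      (if alg.regret s₁ r P ω D ≤ b / δ then 1 else 0)) alg.law := by
    refine alg.integrable_of_measurable_bounded (c := 1)
      (Finset.measurable_sum _ fun D _ => (alg.measurable_dataProb s₁ P D).mul
        (Measurable.ite (measurableSet_le (alg.measurable_regret s₁ r P D) measurable_const)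
          measurable_const measurable_const))
      (fun ω => Finset.sum_nonneg fun D _ =>
        mul_nonneg (alg.dataProb_nonneg s₁ P ω D) (by split_ifs <;> norm_num)) fun ω => ?_
    refine (Finset.sum_le_sum fun D _ => mul_le_mul_of_nonneg_left
      (show _ ≤ (1 : ℝ) by split_ifs <;> norm_num) (alg.dataProb_nonneg s₁ P ω D)).trans ?_
    simp [sum_dataProb]
  have h1 : ∫ ω, (1 - (b / δ)⁻¹ * ∑ D, alg.dataProb s₁ P ω D * alg.regret s₁ r P ω D) ∂alg.law ≤
      alg.probRegretLE s₁ r P (b / δ) := by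
    rw [probRegretLE]
    refine integral_mono ((integrable_const 1).sub (hi1.const_mul _)) ?_ fun ω => ?_
    · convert hi2
    · dsimp only
      have hs : 1 - (b / δ)⁻¹ * ∑ D, alg.dataProb s₁ P ω D * alg.regret s₁ r P ω D =
          ∑ D, alg.dataProb s₁ P ω D * (1 - (b / δ)⁻¹ * alg.regret s₁ r P ω D) := by
        simp only [mul_sub, mul_one, Finset.sum_sub_distrib, sum_dataProb, Finset.mul_sum]
        congr 1
        exact Finset.sum_congr rfl fun D _ => by ring
      rw [hs]
      refine Finset.sum_le_sum fun D _ => ?_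
      have h2 := alg.dataProb_nonneg s₁ P ω D
      have h3 := alg.regret_nonneg s₁ r P ω D
      -- Markov's inequality pointwise: the indicator of `R ≤ c` is at least `1 - R / c`.
      have h4 : 1 - (b / δ)⁻¹ * alg.regret s₁ r P ω D ≤
          if alg.regret s₁ r P ω D ≤ b / δ then 1 else 0 := by
        split_ifs with h5
        · have : 0 ≤ (b / δ)⁻¹ * alg.regret s₁ r P ω D := by positivity
          linarith
        · have : 1 ≤ (b / δ)⁻¹ * alg.regret s₁ r P ω D := by
            rw [inv_mul_eq_div, one_le_div hc]
            exact (not_le.1 h5).le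
          linarith
      have h6 := mul_le_mul_of_nonneg_left h4 h2
      exact h6.trans (le_of_eq (by congr))
  refine le_trans ?_ h1
  rw [integral_sub (integrable_const 1) (hi1.const_mul _), integral_const_mul]
  simp only [integral_const, probReal_univ, smul_eq_mul, mul_one]
  have h7 : (b / δ)⁻¹ * alg.expectedRegret s₁ r P ≤ (b / δ)⁻¹ * b :=
    mul_le_mul_of_nonneg_left h (by positivity)
  have h8 : (b / δ)⁻¹ * b = δ := by field_simp
  rw [expectedRegret] at h7
  linarith

end Regret

end BatchAlgorithm

/-- The tower property: draw number `k` may be replaced by its conditional mean given the first `k`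
draws, numbered from 0. The default 0 is never used on histories of length `n`. -/
theorem seqSum_draw {T : Type*} [Fintype T] {g : List T → T → ℝ} (hg : ∀ l, ∑ x, g l x = 1)
    {k n : ℕ} (hk : k < n) (F : T → ℝ) :
    seqSum g n (fun l => if h : k < l.length then F l[k] else 0) [] =
      seqSum g n (fun l => ∑ x, g (l.take k) x * F x) [] := by
  have h1 : ∀ l : List T, (if h : k < (l.take (k + 1)).length then F (l.take (k + 1))[k] else 0) =
      if h : k < l.length then F l[k] else 0 := fun l => by simp
  have h2 : ∀ l : List T, ∑ x, g ((l.take k).take k) x * F x = ∑ x, g (l.take k) x * F x :=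
    fun l => by rw [List.take_take, min_self]
  rw [seqSum_of_take hg (show k + 1 ≤ n from hk) h1, seqSum_steps_add, seqSum_of_take hg hk.le h2]
  refine seqSum_congr fun r hr => ?_
  simp [seqSum, ← hr]

namespace BatchAlgorithm

/-- The integral of a non-integrable function is 0 by convention, so a positive value already gives
integrability. -/
theorem integrable_of_probRegretLE_pos {alg : BatchAlgorithm.{u} S A H K M} {s₁ : Fin S}
    {r : Reward S A H} {P : Transition S A H} {b : ℝ} (h : 0 < alg.probRegretLE s₁ r P b) :
    Integrable (fun ω => ∑ D, alg.dataProb s₁ P ω D *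
      (if alg.regret s₁ r P ω D ≤ b then 1 else 0)) alg.law := by
  by_contra hn
  refine h.ne' ((integral_undef ?_))
  convert hn

/-! ### Few batches cannot open the lock -/

section LockRegret

/-- The probability that `π` plays the secret actions in the steps `m L, …, (m + 1) L - 1`. -/
noncomputable def lockGuess (s₁ : Fin S) (L m : ℕ) (a : Fin H → Fin A) (π : Policy S A H) : ℝ :=
  ∏ h : Fin H, if m * L ≤ h.val ∧ h.val < (m + 1) * L then (π h s₁).1 (a h) else 1

theorem policy_apply_le_one (π : Policy S A H) (h : Fin H) (s : Fin S) (a : Fin A) :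
    (π h s).1 a ≤ 1 := by
  rw [← (π h s).2.2]
  exact Finset.single_le_sum (fun i _ => (π h s).2.1 i) (Finset.mem_univ a)

theorem prod_lt_le_lockGuess (s₁ : Fin S) {L m : ℕ} (a : Fin H → Fin A) (π : Policy S A H)
    {n : Fin H} (hn : (m + 1) * L ≤ n.val) :
    ∏ h, (if h < n then (π h s₁).1 (a h) else 1) ≤ lockGuess s₁ L m a π := by
  refine Finset.prod_le_prod (fun h _ => ?_) fun h _ => ?_
  · split_ifs
    exacts [(π h s₁).2.1 _, zero_le_one]
  · by_cases h1 : m * L ≤ h.val ∧ h.val < (m + 1) * L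
    · have : h < n := Fin.lt_def.2 (by omega)
      simp [h1, this]
    · rw [if_neg h1]
      split_ifs
      exacts [policy_apply_le_one _ _ _ _, le_rfl]

theorem lockGuess_nonneg (s₁ : Fin S) (L m : ℕ) (a : Fin H → Fin A) (π : Policy S A H) :
    0 ≤ lockGuess s₁ L m a π :=
  Finset.prod_nonneg fun h _ => by
    split_ifs
    exacts [(π h s₁).2.1 _, zero_le_one]

theorem card_filter_block {L m : ℕ} (hm : (m + 1) * L ≤ H) :
    (Finset.univ.filter fun h : Fin H => m * L ≤ h.val ∧ h.val < (m + 1) * L).card = L := by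
  have h : (Finset.univ.filter fun h : Fin H => m * L ≤ h.val ∧ h.val < (m + 1) * L).map
      Fin.valEmbedding = Finset.Ico (m * L) ((m + 1) * L) := by
    ext k
    simp only [Finset.mem_map, Finset.mem_filter, Finset.mem_univ, true_and,
      Fin.valEmbedding_apply, Finset.mem_Ico]
    exact ⟨by rintro ⟨i, hi, rfl⟩; exact hi, fun hk => ⟨⟨k, by omega⟩, hk, rfl⟩⟩
  rw [← Finset.card_map Fin.valEmbedding, h, Nat.card_Ico, add_mul, one_mul,
    Nat.add_sub_cancel_left]

/-- The vector `c` restricted to the steps `m L, …, (m + 1) L - 1`. -/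
def blockPart [NeZero A] (L m : ℕ) (c : Fin H → Fin A) : Fin H → Fin A :=
  fun h => if m * L ≤ h.val ∧ h.val < (m + 1) * L then c h else 0

/-- Shifting by a uniform `c` makes the secrets of the block uniform, so any fixed policy guesses
them with mean probability `A ^ (-L)`. The sum factors over the steps: a step in the block
contributes 1, any other `A`. -/
theorem sum_lockGuess_add [NeZero A] (s₁ : Fin S) {L m : ℕ} (hm : (m + 1) * L ≤ H)
    (a : Fin H → Fin A) (π : Policy S A H) :
    (∑ c, lockGuess s₁ L m (a + blockPart L m c) π) * (A : ℝ) ^ L = (A : ℝ) ^ H := by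
  have h1 : ∀ c, lockGuess s₁ L m (a + blockPart L m c) π = ∏ h : Fin H,
      (fun h x => if m * L ≤ h.val ∧ h.val < (m + 1) * L then (π h s₁).1 (a h + x) else 1)
        h (c h) := by
    intro c
    refine Finset.prod_congr rfl fun h _ => ?_
    by_cases hh : m * L ≤ h.val ∧ h.val < (m + 1) * L <;> simp [hh, blockPart]
  simp only [h1]
  have h2 := Finset.prod_univ_sum (fun _ : Fin H => (Finset.univ : Finset (Fin A)))
    (fun h x => if m * L ≤ h.val ∧ h.val < (m + 1) * L then (π h s₁).1 (a h + x) else 1)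
  rw [Fintype.piFinset_univ] at h2
  rw [← h2]
  have h3 : ∀ h : Fin H, ∑ x, (if m * L ≤ h.val ∧ h.val < (m + 1) * L then
      (π h s₁).1 (a h + x) else 1) =
        if m * L ≤ h.val ∧ h.val < (m + 1) * L then 1 else (A : ℝ) := by
    intro h
    split_ifs
    · rw [← (π h s₁).2.2]
      exact Equiv.sum_comp (Equiv.addLeft (a h)) fun x => (π h s₁).1 x
    · simp
  have h4 : (A : ℝ) ^ L =
      ∏ h : Fin H, if m * L ≤ h.val ∧ h.val < (m + 1) * L then (A : ℝ) else 1 := by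
    rw [← Finset.prod_filter, Finset.prod_const, card_filter_block hm]
  rw [Finset.prod_congr rfl fun h _ => h3 h, h4, ← Finset.prod_mul_distrib]
  rw [Finset.prod_congr rfl fun h _ => (show _ = (A : ℝ) by split_ifs <;> simp)]
  simp

variable (alg : BatchAlgorithm.{u} S A H K M) (ω : alg.Seed) [NeZero M] (s₁ b : Fin S) (L : ℕ)

/-- The law of the next trajectory in the lock truncated after `L` steps per batch. -/
noncomputable def lockKernel (a : Fin H → Fin A) (l : List (Trajectory S A H))
    (τ : Trajectory S A H) : ℝ :=
  trajProb s₁ (lockModel s₁ b a (((alg.batchOf ω l.length).val + 1) * L)) (alg.histPolicy ω l) τ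

theorem sum_lockKernel (a : Fin H → Fin A) (l : List (Trajectory S A H)) :
    ∑ τ, alg.lockKernel ω s₁ b L a l τ = 1 :=
  sum_trajProb _ _ _

theorem lockKernel_nonneg (a : Fin H → Fin A) (l : List (Trajectory S A H))
    (τ : Trajectory S A H) : 0 ≤ alg.lockKernel ω s₁ b L a l τ :=
  trajProb_nonneg _ _ _ _

/-- Every earlier batch runs in a lock truncated at or before step `m * L`, where the secrets of
block `m` have no effect. -/
theorem lockKernel_add_blockPart [NeZero A] (m : Fin M) (a c : Fin H → Fin A)
    {l : List (Trajectory S A H)} (hl : l.length < alg.start m ω) :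
    alg.lockKernel ω s₁ b L (a + blockPart L m c) l = alg.lockKernel ω s₁ b L a l := by
  have h1 : alg.batchOf ω l.length < m := by
    have h2 := alg.start_add_len_le ω m
    have h3 := (alg.batchOf_spec ω (k := l.length) (by omega)).1
    rcases lt_trichotomy (alg.batchOf ω l.length) m with h | h | h
    · exact h
    · rw [h] at h3
      omega
    · have := alg.start_add_len_le_start ω h
      omega
  funext τ
  rw [lockKernel, lockModel_congr s₁ b (a' := a)]
  · rfl
  · intro i hi
    have h2 : ((alg.batchOf ω l.length).val + 1) * L ≤ m.val * L :=
      Nat.mul_le_mul_right _ (Fin.lt_def.1 h1)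
    have h3 : ¬ (m.val * L ≤ i.val ∧ i.val < (m.val + 1) * L) := by omega
    simp [blockPart, h3]

/-- The expected probability, in the truncated lock, that the policy of batch `m` guesses the
secret actions of its block. -/
noncomputable def expectedGuess (m : Fin M) (a : Fin H → Fin A) : ℝ :=
  seqSum (alg.lockKernel ω s₁ b L a) (alg.start m ω)
    (fun l => lockGuess s₁ L m a (alg.policy m ω (l.take (alg.start m ω)))) []

/-- The sum over `a` is invariant under each shift of block `m`. After averaging over the shifts,
the law of the data no longer depends on the shift, so the average moves inside to the guess alone.
-/
theorem sum_expectedGuess [NeZero A] (m : Fin M) (hm : (m.val + 1) * L ≤ H) :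
    (∑ a, alg.expectedGuess ω s₁ b L m a) * (A : ℝ) ^ L = (A : ℝ) ^ H := by
  have h1 : ∀ c : Fin H → Fin A, ∑ a, alg.expectedGuess ω s₁ b L m a =
      ∑ a, alg.expectedGuess ω s₁ b L m (a + blockPart L m c) := fun c =>
    (Equiv.sum_comp (Equiv.addRight (blockPart L m c)) _).symm
  have h2 : (A : ℝ) ^ H * ∑ a, alg.expectedGuess ω s₁ b L m a =
      ∑ c, ∑ a, alg.expectedGuess ω s₁ b L m (a + blockPart L m c) := by
    simp [← h1]
  have h3 : ∀ a : Fin H → Fin A, (∑ c, alg.expectedGuess ω s₁ b L m (a + blockPart L m c)) *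
      (A : ℝ) ^ L = (A : ℝ) ^ H := by
    intro a
    have h4 : ∀ c, alg.expectedGuess ω s₁ b L m (a + blockPart L m c) =
        seqSum (alg.lockKernel ω s₁ b L a) (alg.start m ω)
          (fun l => lockGuess s₁ L m (a + blockPart L m c)
            (alg.policy m ω (l.take (alg.start m ω)))) [] := fun c =>
      seqSum_congr_kernel (fun l hl => alg.lockKernel_add_blockPart ω s₁ b L m a c hl) (by simp)
    simp only [h4]
    rw [← seqSum_sum, mul_comm, ← seqSum_const_mul]
    refine (seqSum_congr fun r _ => ?_).trans
      (seqSum_const (alg.sum_lockKernel ω s₁ b L a) (alg.start m ω) ((A : ℝ) ^ H) [])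
    rw [mul_comm]
    exact sum_lockGuess_add s₁ hm a _
  rw [Finset.sum_comm] at h2
  have h5 : (A : ℝ) ^ H * ((∑ a, alg.expectedGuess ω s₁ b L m a) * (A : ℝ) ^ L) =
      (A : ℝ) ^ H * (A : ℝ) ^ H := by
    rw [← mul_assoc, h2, Finset.sum_mul]
    simp [h3]
  have hA : (A : ℝ) ≠ 0 := Nat.cast_ne_zero.2 (NeZero.ne A)
  exact mul_left_cancel₀ (pow_ne_zero H hA) h5

theorem seqSum_lockGuess (a : Fin H → Fin A) {k : ℕ} (hk : k < K) :
    seqSum (alg.lockKernel ω s₁ b L a) K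
      (fun l => lockGuess s₁ L (alg.batchOf ω k) a (alg.histPolicy ω (l.take k))) [] =
      alg.expectedGuess ω s₁ b L (alg.batchOf ω k) a := by
  have h := (alg.batchOf_spec ω hk).1
  have h1 : ∀ l : List (Trajectory S A H), lockGuess s₁ L (alg.batchOf ω k) a
      (alg.policy (alg.batchOf ω k) ω ((l.take (alg.start (alg.batchOf ω k) ω)).take
        (alg.start (alg.batchOf ω k) ω))) = lockGuess s₁ L (alg.batchOf ω k) a
      (alg.policy (alg.batchOf ω k) ω (l.take (alg.start (alg.batchOf ω k) ω))) :=
    fun l => by rw [List.take_take, min_self]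
  rw [expectedGuess, ← seqSum_of_take (n := K) (alg.sum_lockKernel ω s₁ b L a)
    (h.trans hk.le) h1]
  refine seqSum_congr fun l hl => ?_
  have hl' : (l.take k).length = k := by simp [hl, hk.le]
  rw [List.nil_append, histPolicy, hl', List.take_take, min_eq_left h]

/-- Low regret in the true lock needs one of two unlikely events of the truncated process: an
episode survives its block (union bound, the term 1), or the guesses sum to at least `K / 2`
(Markov, the term `2 / K`). -/
theorem sum_dataProb_lockModel_le {b : Fin S} (hb : b ≠ s₁) (hK : 0 < K) (hL : M * L < H)
    (e : Fin H) (he : e.val + 1 = H) {β : ℝ} (hβ : 2 * β < K) (a : Fin H → Fin A) :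
    ∑ D, alg.dataProb s₁ (lockModel s₁ b a H) ω D *
      (if alg.regret s₁ (stepReward s₁ e) (lockModel s₁ b a H) ω D ≤ β then 1 else 0) ≤
      (1 + 2 / (K : ℝ)) * ∑ k : Fin K, alg.expectedGuess ω s₁ b L (alg.batchOf ω k) a := by
  have hK' : (0 : ℝ) < K := by exact_mod_cast hK
  have hnk : ∀ m : Fin M, (m.val + 1) * L < H := fun m =>
    (Nat.mul_le_mul_right L m.isLt).trans_lt hL
  set P := lockModel s₁ b a H
  set r : Reward S A H := stepReward s₁ e
  -- The first step after the block of the batch of episode `k`; `M * L < H` makes it a valid step.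
  let n : ℕ → Fin H := fun k => ⟨((alg.batchOf ω k).val + 1) * L, hnk _⟩
  let φ : Fin K → List (Trajectory S A H) → ℝ := fun k l =>
    lockGuess s₁ L (alg.batchOf ω k) a (alg.histPolicy ω (l.take k))
  let surv : Fin K → List (Trajectory S A H) → ℝ := fun k l =>
    if h : k.val < l.length then (if l[k.val].state s₁ (n k) = s₁ then 1 else 0) else 0
  let W : (Fin K → Trajectory S A H) → ℝ := fun D =>
    ∏ k : Fin K, alg.lockKernel ω s₁ b L a ((List.ofFn D).take k) (D k)
  have hW : ∀ D, 0 ≤ W D := fun D => Finset.prod_nonneg fun k _ =>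
    alg.lockKernel_nonneg ω s₁ b L a _ _
  have hWsum : ∀ f : List (Trajectory S A H) → ℝ, ∑ D, W D * f (List.ofFn D) =
      seqSum (alg.lockKernel ω s₁ b L a) K f [] := by
    intro f
    rw [seqSum_eq_sum]
    simp only [List.nil_append, W]
  have hφ0 : ∀ k l, 0 ≤ φ k l := fun k l => lockGuess_nonneg _ _ _ _ _
  have hsurv0 : ∀ k l, 0 ≤ surv k l := by
    intro k l
    simp only [surv]
    split_ifs <;> norm_num
  have hφ : ∀ k : Fin K, ∑ D, W D * φ k (List.ofFn D) =
      alg.expectedGuess ω s₁ b L (alg.batchOf ω k) a := fun k => by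
    rw [hWsum]
    exact alg.seqSum_lockGuess ω s₁ b L a k.isLt
  have hsurv : ∀ k : Fin K, ∑ D, W D * surv k (List.ofFn D) ≤
      alg.expectedGuess ω s₁ b L (alg.batchOf ω k) a := by
    intro k
    rw [hWsum, ← alg.seqSum_lockGuess ω s₁ b L a k.isLt]
    simp only [surv]
    rw [seqSum_draw (alg.sum_lockKernel ω s₁ b L a) k.isLt
      fun τ => if Trajectory.state s₁ τ (n k) = s₁ then 1 else 0]
    refine seqSum_mono (alg.lockKernel_nonneg ω s₁ b L a) fun l hl => ?_
    have hl' : (l.take k).length = k := by simp [hl]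
    simp only [List.nil_append, lockKernel, hl']
    rw [sum_trajProb_lockModel hb a (n k) le_rfl]
    exact prod_lt_le_lockGuess s₁ a _ le_rfl
  have hreg : ∀ D, (K : ℝ) - ∑ k, φ k (List.ofFn D) ≤ alg.regret s₁ r P ω D := by
    intro D
    rw [regret_eq_sum]
    have : (K : ℝ) = ∑ _k : Fin K, (1 : ℝ) := by simp
    rw [this, ← Finset.sum_sub_distrib]
    refine Finset.sum_le_sum fun k _ => ?_
    have h1 := one_le_optValue_lockModel hb a e
    have h2 : value s₁ r P (alg.histPolicy ω ((List.ofFn D).take k)) ≤ φ k (List.ofFn D) := by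
      rw [value_lockModel hb a e]
      refine prod_lt_le_lockGuess s₁ a _ ?_
      have := hnk (alg.batchOf ω k)
      omega
    linarith
  -- If the regret is low or an episode survives, the left side is nonpositive. Otherwise the
  -- truncated law is dominated by the true one, trajectory by trajectory.
  have hpt : ∀ D, W D * (1 - ∑ k, surv k (List.ofFn D) - 2 / K * ∑ k, φ k (List.ofFn D)) ≤
      alg.dataProb s₁ P ω D * (1 - if alg.regret s₁ r P ω D ≤ β then 1 else 0) := by
    intro D
    have hS : 0 ≤ ∑ k, surv k (List.ofFn D) := Finset.sum_nonneg fun k _ => hsurv0 k _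
    have hΦ : 0 ≤ ∑ k, φ k (List.ofFn D) := Finset.sum_nonneg fun k _ => hφ0 k _
    have hKΦ : 0 ≤ 2 / (K : ℝ) * ∑ k, φ k (List.ofFn D) := by positivity
    have hdp := alg.dataProb_nonneg s₁ P ω D
    split_ifs with h1
    · have h2 := hreg D
      have h3 : 1 ≤ 2 / (K : ℝ) * ∑ k, φ k (List.ofFn D) := by
        rw [div_mul_eq_mul_div, one_le_div hK']
        linarith
      rw [sub_self, mul_zero]
      exact mul_nonpos_of_nonneg_of_nonpos (hW D) (by linarith)
    · rw [sub_zero, mul_one]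
      by_cases h2 : ∃ k : Fin K, (D k).state s₁ (n k) = s₁
      · obtain ⟨k, hk⟩ := h2
        have h3 : 1 ≤ ∑ k, surv k (List.ofFn D) := by
          refine le_trans (le_of_eq ?_)
            (Finset.single_le_sum (fun k _ => hsurv0 k _) (Finset.mem_univ k))
          simp [surv, hk]
        exact (mul_nonpos_of_nonneg_of_nonpos (hW D) (by linarith)).trans hdp
      · push Not at h2
        have h3 : W D ≤ alg.dataProb s₁ P ω D := by
          rw [dataProb_eq_prod]
          refine Finset.prod_le_prod (fun k _ => alg.lockKernel_nonneg ω s₁ b L a _ _)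
            fun k _ => ?_
          have h4 := trajProb_lockModel_le hb a (n k) (n k).isLt.le
            (alg.histPolicy ω ((List.ofFn D).take k)) (D k)
          rw [if_neg (h2 k)] at h4
          have hl' : ((List.ofFn D).take k).length = k := by simp
          rw [lockKernel, hl']
          exact h4
        refine le_trans ?_ h3
        exact mul_le_of_le_one_right (hW D) (by linarith)
  have hsum := Finset.sum_le_sum fun D (_ : D ∈ Finset.univ) => hpt D
  have e1 : ∑ D, W D * (1 - ∑ k, surv k (List.ofFn D) - 2 / K * ∑ k, φ k (List.ofFn D)) =
      1 - ∑ k, ∑ D, W D * surv k (List.ofFn D) -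
        2 / K * ∑ k, ∑ D, W D * φ k (List.ofFn D) := by
    have hW1 : ∑ D, W D = 1 := by
      have := hWsum fun _ => 1
      rw [seqSum_const (alg.sum_lockKernel ω s₁ b L a)] at this
      simpa using this
    simp only [mul_sub, mul_one, Finset.sum_sub_distrib, hW1]
    congr 1
    · congr 1
      simp only [Finset.mul_sum]
      exact Finset.sum_comm
    · rw [Finset.sum_comm]
      simp only [Finset.mul_sum]
      exact Finset.sum_congr rfl fun _ _ => Finset.sum_congr rfl fun _ _ => by ring
  rw [e1] at hsum
  simp only [mul_sub, mul_one, Finset.sum_sub_distrib, sum_dataProb, hφ] at hsum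
  have h6 := Finset.sum_le_sum fun k (_ : k ∈ Finset.univ) => hsurv k
  rw [add_mul, one_mul]
  linarith

end LockRegret

/-- Few batches with a low regret are enough only to find few secret actions of the lock. -/
theorem horizon_le_of_probRegretLE (alg : BatchAlgorithm.{u} S A H K M) {s₁ b : Fin S}
    (hb : b ≠ s₁) (hA : 0 < A) (hK : 0 < K) {L : ℕ} (hL : 2 * (K + 2) ≤ A ^ L)
    (e : Fin H) (he : e.val + 1 = H) {β δ : ℝ} (hβ : 2 * β < K) (hδ : δ < 1 / 2)
    (h : ∀ P, 1 - δ ≤ alg.probRegretLE s₁ (stepReward s₁ e) P β) : H ≤ M * L := by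
  by_contra hML
  push Not at hML
  have : NeZero M := ⟨(alg.batches_pos hK).ne'⟩
  have : NeZero A := ⟨hA.ne'⟩
  have hK' : (0 : ℝ) < K := by exact_mod_cast hK
  have hA' : (0 : ℝ) < A := by exact_mod_cast hA
  have h1 : ∀ ω, ∑ a : Fin H → Fin A, ∑ D, alg.dataProb s₁ (lockModel s₁ b a H) ω D *
      (if alg.regret s₁ (stepReward s₁ e) (lockModel s₁ b a H) ω D ≤ β then 1 else 0) ≤
        (A : ℝ) ^ H / 2 := by
    intro ω
    refine (Finset.sum_le_sum fun a _ =>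
      alg.sum_dataProb_lockModel_le ω s₁ L hb hK hML e he hβ a).trans ?_
    rw [← Finset.mul_sum, Finset.sum_comm]
    have h2 : ∀ m : Fin M, ∑ a, alg.expectedGuess ω s₁ b L m a = (A : ℝ) ^ H / (A : ℝ) ^ L := by
      intro m
      rw [eq_div_iff (by positivity)]
      exact alg.sum_expectedGuess ω s₁ b L m
        ((Nat.mul_le_mul_right L m.isLt).trans hML.le)
    simp only [h2, Finset.sum_const, Finset.card_univ, Fintype.card_fin, nsmul_eq_mul]
    have h3 : (2 * (K + 2) : ℝ) ≤ (A : ℝ) ^ L := by exact_mod_cast hL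
    -- The mean over the secrets is `(K + 2) / A ^ L`, which `hL` makes at most 1/2, whereas every
    -- secret needs `1 - δ > 1/2`.
    have h4 : (1 + 2 / (K : ℝ)) * (K * ((A : ℝ) ^ H / (A : ℝ) ^ L)) =
        (K + 2) * (A : ℝ) ^ H / (A : ℝ) ^ L := by field_simp
    rw [h4, div_le_div_iff₀ (by positivity) two_pos]
    have := mul_le_mul_of_nonneg_right h3 (by positivity : 0 ≤ (A : ℝ) ^ H)
    linarith
  have hint : ∀ a : Fin H → Fin A, Integrable (fun ω => ∑ D,
      alg.dataProb s₁ (lockModel s₁ b a H) ω D * (if alg.regret s₁ (stepReward s₁ e)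
        (lockModel s₁ b a H) ω D ≤ β then 1 else 0)) alg.law := fun a =>
    integrable_of_probRegretLE_pos (lt_of_lt_of_le (by linarith) (h (lockModel s₁ b a H)))
  have h5 := integral_mono (integrable_finsetSum Finset.univ fun a _ => hint a)
    (integrable_const ((A : ℝ) ^ H / 2)) h1
  rw [integral_finsetSum _ fun a _ => hint a] at h5
  simp only [integral_const, probReal_univ, smul_eq_mul, one_mul] at h5
  have h6 : ∑ _a : Fin H → Fin A, (1 - δ) ≤ (A : ℝ) ^ H / 2 := by
    refine le_trans (Finset.sum_le_sum fun a _ => ?_) h5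
    refine (h (lockModel s₁ b a H)).trans (le_of_eq ?_)
    rw [probRegretLE]
  simp only [Finset.sum_const, Finset.card_univ, Fintype.card_fun, Fintype.card_fin, nsmul_eq_mul,
    Nat.cast_pow] at h6
  have h7 : 0 < (A : ℝ) ^ H := by positivity
  nlinarith

end BatchAlgorithm

namespace BatchAlgorithm

/-! ### Every level contains the end of a batch -/

section BanditRegret

theorem seqSum_kernel_banditModel (alg : BatchAlgorithm.{u} S A (H + 2) K M) (ω : alg.Seed)
    [NeZero M] {s₁ b : Fin S} (hb : b ≠ s₁) (a₁ : Fin A) (x : unitInterval) {η : ℝ} (hη : 0 < η)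
    {t : ℕ} (ht : (1 + 4 * ((x : ℝ) - 1 / 2) ^ 2) ^ t ≤ 1 + η ^ 2)
    {f : List (Trajectory S A (H + 2)) → ℝ} (hf0 : ∀ l, 0 ≤ f l) (hf1 : ∀ l, f l ≤ 1) :
    seqSum (alg.kernel ω s₁ (banditModel s₁ b a₁ x)) t f [] ≤
      seqSum (alg.kernel ω s₁ (banditModel s₁ b a₁ fairParam)) t f [] + η := by
  have h1 : alg.kernel ω s₁ (banditModel s₁ b a₁ x) = fun l τ =>
      alg.kernel ω s₁ (banditModel s₁ b a₁ fairParam) l τ * banditRatio s₁ a₁ x (τ 0) := by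
    funext l τ
    exact trajProb_banditModel hb a₁ x _ τ
  rw [h1]
  refine seqSum_reweight_le (alg.kernel_nonneg ω s₁ _) (alg.sum_kernel ω s₁ _) (fun l => ?_)
    (by positivity) (fun l => sum_trajProb_banditRatio_sq hb a₁ x _) hf0 hf1 hη ht
  have := alg.sum_kernel ω s₁ (banditModel s₁ b a₁ x) l
  rwa [h1] at this

/-- The test `f` dominates the success event but reads only `t` episodes, so the change of measure
to the fair bandit costs `t` likelihood factors rather than `K`. -/
theorem sum_dataProb_banditModel_le (alg : BatchAlgorithm.{u} S A (H + 2) K M) (ω : alg.Seed)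
    [NeZero M] {s₁ b : Fin S} (hb : b ≠ s₁) (a₁ : Fin A) (x : unitInterval) {η : ℝ} (hη : 0 < η)
    {t : ℕ} (htK : t ≤ K) (ht : (1 + 4 * ((x : ℝ) - 1 / 2) ^ 2) ^ t ≤ 1 + η ^ 2)
    {f : List (Trajectory S A (H + 2)) → ℝ} (hf0 : ∀ l, 0 ≤ f l) (hf1 : ∀ l, f l ≤ 1)
    (hft : ∀ l, f (l.take t) = f l) {β : ℝ}
    (hf : ∀ D, alg.regret s₁ (stepReward s₁ 1) (banditModel s₁ b a₁ x) ω D ≤ β →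
      1 ≤ f (List.ofFn D)) :
    ∑ D, alg.dataProb s₁ (banditModel s₁ b a₁ x) ω D *
      (if alg.regret s₁ (stepReward s₁ 1) (banditModel s₁ b a₁ x) ω D ≤ β then 1 else 0) ≤
      seqSum (alg.kernel ω s₁ (banditModel s₁ b a₁ fairParam)) t f [] + η := by
  refine le_trans ?_ (alg.seqSum_kernel_banditModel ω hb a₁ x hη ht hf0 hf1)
  rw [← seqSum_of_take (alg.sum_kernel ω s₁ _) htK hft, ← sum_dataProb_mul]
  refine Finset.sum_le_sum fun D _ => mul_le_mul_of_nonneg_left ?_ (alg.dataProb_nonneg _ _ _ _)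
  split_ifs with h
  exacts [hf D h, hf0 _]

/-- The bandit parameter `1/2 + d`. -/
noncomputable def shiftParam (d : ℝ) (hd : |d| ≤ 1 / 2) : unitInterval :=
  ⟨1 / 2 + d, by linarith [(abs_le.1 hd).1], by linarith [(abs_le.1 hd).2]⟩

open Classical in
/-- The conditional probability, given the seed, that the regret is at most `β` in the bandit with
parameter `1/2 + d`. -/
noncomputable def banditSuccess (alg : BatchAlgorithm.{u} S A (H + 2) K M) (s₁ b : Fin S)
    (a₁ : Fin A) (β : ℝ) (d : ℝ) (hd : |d| ≤ 1 / 2) (ω : alg.Seed) : ℝ :=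
  ∑ D, alg.dataProb s₁ (banditModel s₁ b a₁ (shiftParam d hd)) ω D *
    (if alg.regret s₁ (stepReward s₁ 1) (banditModel s₁ b a₁ (shiftParam d hd)) ω D ≤ β
      then 1 else 0)

theorem banditSuccess_le_one (alg : BatchAlgorithm.{u} S A (H + 2) K M) [NeZero M] (s₁ b : Fin S)
    (a₁ : Fin A) (β : ℝ) (d : ℝ) (hd : |d| ≤ 1 / 2) (ω : alg.Seed) :
    alg.banditSuccess s₁ b a₁ β d hd ω ≤ 1 := by
  rw [← alg.sum_dataProb ω s₁ (banditModel s₁ b a₁ (shiftParam d hd))]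
  refine Finset.sum_le_sum fun D _ => mul_le_of_le_one_right (alg.dataProb_nonneg _ _ _ _) ?_
  split_ifs <;> norm_num

/-- A long batch whose policy is chosen from few episodes has a large regret in one of the two
bandits with parameters `1/2 + d` and `1/2 - d`. -/
theorem banditSuccess_add_le (alg : BatchAlgorithm.{u} S A (H + 2) K M) [NeZero M]
    {s₁ b : Fin S} (hb : b ≠ s₁) {a₁ a₂ : Fin A} (ha : a₂ ≠ a₁) {β d η : ℝ} (hd : |d| ≤ 1 / 2)
    (hd' : |-d| ≤ 1 / 2) (hη : 0 < η) (ω : alg.Seed) (m : Fin M)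
    (ht : (1 + 4 * d ^ 2) ^ alg.start m ω ≤ 1 + η ^ 2) (hlen : 2 * β < alg.len m ω * d) :
    alg.banditSuccess s₁ b a₁ β d hd ω + alg.banditSuccess s₁ b a₁ β (-d) hd' ω ≤ 1 + 2 * η := by
  classical
  set t := alg.start m ω
  let q : List (Trajectory S A (H + 2)) → ℝ := fun l => (alg.policy m ω (l.take t) 0 s₁).1 a₁
  -- `f₁` asks that batch `m` play `a₁` almost always, as low regret at `1/2 + d` requires; `f₂`
  -- asks that it play `a₁` rarely, as `1/2 - d` requires. Both cannot be 1, since the two costs add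
  -- up to `len * d > 2 * β`.
  let f₁ : List (Trajectory S A (H + 2)) → ℝ := fun l =>
    if alg.len m ω * (d * (1 - q l)) ≤ β then 1 else 0
  let f₂ : List (Trajectory S A (H + 2)) → ℝ := fun l =>
    if alg.len m ω * (d * q l) ≤ β then 1 else 0
  have htK : t ≤ K := (Nat.le_add_right _ _).trans (alg.start_add_len_le ω m)
  have hq : ∀ l, q (l.take t) = q l := fun l => by
    simp only [q]
    rw [List.take_take, min_self]
  have hreg : ∀ x D, alg.len m ω * (optValue s₁ (stepReward s₁ 1) (banditModel (H := H) s₁ b a₁ x) -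
      (1 / 2 + ((x : ℝ) - 1 / 2) * q (List.ofFn D))) ≤
        alg.regret s₁ (stepReward s₁ 1) (banditModel s₁ b a₁ x) ω D := by
    intro x D
    have := alg.batch_regret_le_regret s₁ (stepReward s₁ 1) (banditModel s₁ b a₁ x) ω D m
    rwa [value_banditModel hb] at this
  have h1 : alg.banditSuccess s₁ b a₁ β d hd ω ≤
      seqSum (alg.kernel ω s₁ (banditModel s₁ b a₁ fairParam)) t f₁ [] + η := by
    refine alg.sum_dataProb_banditModel_le ω hb a₁ _ hη htK ?_ (fun l => ?_) (fun l => ?_)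
      (fun l => ?_) fun D hD => ?_
    · simpa [shiftParam] using ht
    · simp only [f₁]; split_ifs <;> norm_num
    · simp only [f₁]; split_ifs <;> norm_num
    · simp only [f₁, hq]
    · have h2 := (hreg _ D).trans hD
      have h3 := le_optValue_banditModel (H := H) hb a₁ a₁ (shiftParam d hd)
      simp only [if_true, shiftParam] at h2 h3
      have h4 : alg.len m ω * (d * (1 - q (List.ofFn D))) ≤ β := by
        refine le_trans (mul_le_mul_of_nonneg_left ?_ (Nat.cast_nonneg _)) h2
        linarith
      simp only [f₁, if_pos h4, le_refl]
  have h2 : alg.banditSuccess s₁ b a₁ β (-d) hd' ω ≤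
      seqSum (alg.kernel ω s₁ (banditModel s₁ b a₁ fairParam)) t f₂ [] + η := by
    refine alg.sum_dataProb_banditModel_le ω hb a₁ _ hη htK ?_ (fun l => ?_) (fun l => ?_)
      (fun l => ?_) fun D hD => ?_
    · simpa [shiftParam] using ht
    · simp only [f₂]; split_ifs <;> norm_num
    · simp only [f₂]; split_ifs <;> norm_num
    · simp only [f₂, hq]
    · have h2 := (hreg _ D).trans hD
      have h3 := le_optValue_banditModel (H := H) hb a₁ a₂ (shiftParam (-d) hd')
      simp only [if_neg ha, shiftParam] at h2 h3
      have h4 : alg.len m ω * (d * q (List.ofFn D)) ≤ β := by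
        refine le_trans (mul_le_mul_of_nonneg_left ?_ (Nat.cast_nonneg _)) h2
        linarith
      simp only [f₂, if_pos h4, le_refl]
  have h3 : seqSum (alg.kernel ω s₁ (banditModel s₁ b a₁ fairParam)) t (fun l => f₁ l + f₂ l) [] ≤
      seqSum (alg.kernel ω s₁ (banditModel s₁ b a₁ fairParam)) t (fun _ => 1) [] := by
    refine seqSum_mono (alg.kernel_nonneg ω s₁ _) fun l _ => ?_
    simp only [f₁, f₂]
    split_ifs with h4 h5
    · linarith
    all_goals norm_num
  rw [seqSum_fun_add, seqSum_const (alg.sum_kernel ω s₁ _)] at h3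
  linarith

open Classical in
-- The levels are disjoint, so choosing a batch that ends in each visited level is injective.
theorem card_filter_covered_le (alg : BatchAlgorithm.{u} S A H K M) (ω : alg.Seed) {u : ℕ → ℝ}
    (hu : Monotone u) (N : ℕ) :
    ((Finset.range N).filter fun j => ∃ m, u j ≤ ((alg.start m ω + alg.len m ω : ℕ) : ℝ) ∧
      ((alg.start m ω + alg.len m ω : ℕ) : ℝ) < u (j + 1)).card ≤ M := by
  by_cases hM : M = 0
  · subst hM
    simp
  have : NeZero M := ⟨hM⟩
  let F : ℕ → Fin M := fun j => if h : ∃ m, u j ≤ ((alg.start m ω + alg.len m ω : ℕ) : ℝ) ∧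
      ((alg.start m ω + alg.len m ω : ℕ) : ℝ) < u (j + 1) then h.choose else 0
  have hF : ∀ j, (∃ m, u j ≤ ((alg.start m ω + alg.len m ω : ℕ) : ℝ) ∧
      ((alg.start m ω + alg.len m ω : ℕ) : ℝ) < u (j + 1)) →
      u j ≤ ((alg.start (F j) ω + alg.len (F j) ω : ℕ) : ℝ) ∧
      ((alg.start (F j) ω + alg.len (F j) ω : ℕ) : ℝ) < u (j + 1) := by
    intro j hj
    simp only [F, dif_pos hj]
    exact hj.choose_spec
  refine (Finset.card_le_card_of_injOn F (t := Finset.univ) (fun _ _ => by simp) ?_).trans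
    (by simp)
  intro i hi j hj hij
  have h1 := hF i (Finset.mem_filter.1 hi).2
  have h2 := hF j (Finset.mem_filter.1 hj).2
  rw [hij] at h1
  by_contra hne
  rcases Nat.lt_or_gt_of_ne hne with h | h
  · exact absurd (h1.2.trans_le (hu h)) (not_lt.2 h2.1)
  · exact absurd (h2.2.trans_le (hu h)) (not_lt.2 h1.1)

theorem one_add_pow_le {y z : ℝ} {t : ℕ} (hy : 0 ≤ y) (hz : z ≤ 1 / 2) (h : t * y ≤ z) :
    (1 + y) ^ t ≤ 1 + 2 * z := by
  have hz0 : 0 ≤ z := le_trans (by positivity) h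
  calc (1 + y) ^ t ≤ Real.exp y ^ t :=
        pow_le_pow_left₀ (by linarith) (by linarith [Real.add_one_le_exp y]) t
    _ = Real.exp (t * y) := (Real.exp_nat_mul y t).symm
    _ ≤ Real.exp z := Real.exp_le_exp.2 h
    _ ≤ 1 / (1 - z) := Real.exp_bound_div_one_sub_of_interval hz0 (by linarith)
    _ ≤ 1 + 2 * z := by
      rw [div_le_iff₀ (by linarith)]
      nlinarith

/-- The number of levels `[u j, u (j + 1))` of episodes that the ends of the batches have to visit,
which forces many batches. -/
theorem levels_le_of_probRegretLE (alg : BatchAlgorithm.{u} S A (H + 2) K M) {s₁ b : Fin S}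
    (hb : b ≠ s₁) {a₁ a₂ : Fin A} (ha : a₂ ≠ a₁) (hK : 0 < K) {β δ η : ℝ} (hη : 0 < η)
    (hη' : η ≤ 1 / 2) (hδ : δ < 1) {u : ℕ → ℝ} (hu1 : ∀ j, 1 ≤ u j) (hu : Monotone u) {N : ℕ}
    (hN : u N ≤ K) (hgap : ∀ j < N, 6 * β * √(u j) < η * (u (j + 1) - u j))
    (h : ∀ P, 1 - δ ≤ alg.probRegretLE s₁ (stepReward s₁ 1) P β) :
    N * (1 - 2 * δ - 2 * η) ≤ M := by
  classical
  have : NeZero M := ⟨(alg.batches_pos hK).ne'⟩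
  -- Then `u j * (4 * d j ^ 2) = 4 * η ^ 2 / 9 ≤ η ^ 2 / 2`, small enough for `u j` episodes to be
  -- uninformative.
  let d : ℕ → ℝ := fun j => η / (3 * √(u j))
  have hsq : ∀ j, 1 ≤ √(u j) := fun j => Real.one_le_sqrt.2 (hu1 j)
  have hd0 : ∀ j, 0 < d j := fun j => by
    have := hsq j
    positivity
  have hd1 : ∀ j, d j ≤ 1 / 2 := fun j => by
    have := hsq j
    rw [div_le_iff₀ (by positivity)]
    linarith
  have hd : ∀ j, |d j| ≤ 1 / 2 := fun j => by rw [abs_of_pos (hd0 j)]; exact hd1 j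
  have hd' : ∀ j, |-d j| ≤ 1 / 2 := fun j => by rw [abs_neg]; exact hd j
  have hpt : ∀ ω, ∑ j ∈ Finset.range N, (alg.banditSuccess s₁ b a₁ β (d j) (hd j) ω +
      alg.banditSuccess s₁ b a₁ β (-d j) (hd' j) ω) ≤ N * (1 + 2 * η) + M := by
    intro ω
    have h1 : ∀ j ∈ Finset.range N, alg.banditSuccess s₁ b a₁ β (d j) (hd j) ω +
        alg.banditSuccess s₁ b a₁ β (-d j) (hd' j) ω ≤ (1 + 2 * η) +
          if ∃ m, u j ≤ ((alg.start m ω + alg.len m ω : ℕ) : ℝ) ∧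
            ((alg.start m ω + alg.len m ω : ℕ) : ℝ) < u (j + 1) then 1 else 0 := by
      intro j hj
      split_ifs with hcov
      · have := alg.banditSuccess_le_one s₁ b a₁ β (d j) (hd j) ω
        have := alg.banditSuccess_le_one s₁ b a₁ β (-d j) (hd' j) ω
        linarith
      · have hjN := Finset.mem_range.1 hj
        have hpos : 0 < u j := lt_of_lt_of_le one_pos (hu1 j)
        -- No batch ends inside the level, so the first batch that reaches `u j` starts before it
        -- and runs at least to `u (j + 1)`.
        obtain ⟨m, hm1, hm2⟩ := alg.exists_first_batch ω hpos ((hu hjN.le).trans hN)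
        push Not at hcov
        have hm3 := hcov m hm2
        push_cast at hm3
        rw [add_zero]
        refine alg.banditSuccess_add_le hb ha (hd j) (hd' j) hη ω m ?_ ?_
        · have hz : (alg.start m ω : ℝ) * (4 * d j ^ 2) ≤ η ^ 2 / 2 := by
            have h2 : u j * (4 * d j ^ 2) = 4 * η ^ 2 / 9 := by
              simp only [d, div_pow, mul_pow, Real.sq_sqrt hpos.le]
              field_simp
              norm_num
            have h3 : (alg.start m ω : ℝ) * (4 * d j ^ 2) ≤ u j * (4 * d j ^ 2) :=
              mul_le_mul_of_nonneg_right hm1.le (by positivity)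
            have : 0 ≤ η ^ 2 := sq_nonneg _
            linarith
          have := one_add_pow_le (by positivity) (by nlinarith) hz
          linarith
        · have h2 : u (j + 1) - u j < alg.len m ω := by linarith
          have h3 := hgap j hjN
          have h4 := hsq j
          simp only [d]
          rw [← mul_div_assoc, lt_div_iff₀ (by positivity)]
          have h5 : η * (u (j + 1) - u j) < η * alg.len m ω := mul_lt_mul_of_pos_left h2 hη
          linarith
    refine (Finset.sum_le_sum h1).trans ?_
    rw [Finset.sum_add_distrib, Finset.sum_const, Finset.card_range, nsmul_eq_mul,
      Finset.sum_boole]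
    have := alg.card_filter_covered_le ω hu N
    gcongr
  have hprob : ∀ e he, 1 - δ ≤ ∫ ω, alg.banditSuccess s₁ b a₁ β e he ω ∂alg.law := fun e he =>
    h (banditModel s₁ b a₁ (shiftParam e he))
  have hint : ∀ e he, Integrable (alg.banditSuccess s₁ b a₁ β e he) alg.law := by
    intro e he
    by_contra hn
    have := hprob e he
    rw [integral_undef hn] at this
    linarith
  have h2 := integral_mono (integrable_finsetSum (Finset.range N) fun j _ =>
    (hint (d j) (hd j)).add (hint (-d j) (hd' j))) (integrable_const (N * (1 + 2 * η) + M)) hpt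
  rw [integral_finsetSum _ fun j _ => (hint (d j) (hd j)).add (hint (-d j) (hd' j))] at h2
  simp only [integral_const, probReal_univ, smul_eq_mul, one_mul] at h2
  have h3 : ∑ _j ∈ Finset.range N, (2 * (1 - δ)) ≤ N * (1 + 2 * η) + M := by
    refine le_trans (Finset.sum_le_sum fun j _ => ?_) h2
    have h4 := integral_add (hint (d j) (hd j)) (hint (-d j) (hd' j))
    have h5 := hprob (d j) (hd j)
    have h6 := hprob (-d j) (hd' j)
    simp only [Pi.add_apply] at h4 ⊢
    rw [h4]
    linarith
  rw [Finset.sum_const, Finset.card_range, nsmul_eq_mul] at h3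
  linarith

end BanditRegret

end BatchAlgorithm

/-! ### Choice of parameters -/

section BatchBounds

theorem horizon_div_log_le {s₁ : Fin S} (alg : Reward S A H → BatchAlgorithm.{u} S A H K M)
    (hS : 2 ≤ S) (hA : 2 ≤ A) (hH : 2 ≤ H) (hAK : A ≤ K) (hK4 : 4 ≤ K) {β δ : ℝ}
    (hβ : 2 * β < K) (hδ : δ < 1 / 2)
    (h : ∀ r P, 1 - δ ≤ (alg r).probRegretLE s₁ r P β) :
    1 / 3 * (H / Real.logb A K) ≤ M := by
  have : Nontrivial (Fin S) := Fin.nontrivial_iff_two_le.2 hS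
  obtain ⟨b, hb⟩ := exists_ne s₁
  have hA1 : (1 : ℝ) < A := by exact_mod_cast hA
  have hK0 : (0 : ℝ) < K := by positivity
  set x := Real.logb A K with hx
  have hx1 : 1 ≤ x := by
    rw [hx, Real.le_logb_iff_rpow_le hA1 hK0, Real.rpow_one]
    exact_mod_cast hAK
  -- Then `A ^ L ≥ K ^ 2 ≥ 2 * (K + 2)` as `K ≥ 4`, while `L ≤ 3 * x` as `x ≥ 1`; hence the factor
  -- 1/3.
  set L := ⌈2 * x⌉₊
  have hL1 : 2 * x ≤ L := Nat.le_ceil _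
  have hL2 : (L : ℝ) < 2 * x + 1 := Nat.ceil_lt_add_one (by linarith)
  have hAL : (K : ℝ) ^ 2 ≤ (A : ℝ) ^ L := by
    have h1 : (A : ℝ) ^ x = K := Real.rpow_logb (by linarith) hA1.ne' hK0
    calc (K : ℝ) ^ 2 = (A : ℝ) ^ (2 * x) := by
          rw [mul_comm, Real.rpow_mul (by positivity), h1, Real.rpow_two]
      _ ≤ (A : ℝ) ^ (L : ℝ) := Real.rpow_le_rpow_of_exponent_le hA1.le hL1
      _ = _ := Real.rpow_natCast _ _
  have hAL' : 2 * (K + 2) ≤ A ^ L := by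
    have h1 : K ^ 2 ≤ A ^ L := by exact_mod_cast hAL
    nlinarith
  have hML := (alg (stepReward s₁ ⟨H - 1, by omega⟩)).horizon_le_of_probRegretLE hb (by omega)
    (by omega) hAL' ⟨H - 1, by omega⟩ (by simp; omega) hβ hδ (h _)
  have hML' : (H : ℝ) ≤ M * L := by exact_mod_cast hML
  rw [one_div, inv_mul_eq_div, div_div, div_le_iff₀ (by linarith)]
  refine hML'.trans (mul_le_mul_of_nonneg_left ?_ (Nat.cast_nonneg _))
  linarith

theorem levels_le_batches {s₁ : Fin S} (alg : Reward S A H → BatchAlgorithm.{u} S A H K M)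
    (hS : 2 ≤ S) (hA : 2 ≤ A) (hH : 2 ≤ H) (hK : 1 ≤ K) {β δ η Γ G : ℝ}
    (hη : 0 < η) (hη' : η ≤ 1 / 2) (hδ : δ < 1 / 2) (hβ : β ≤ Γ * √K) (hG1 : 1 ≤ G)
    (hG : η + 6 * Γ < η * G) {N : ℕ}
    (hN : G ^ 2 ≤ (K : ℝ) ^ ((1 / 2 : ℝ) ^ N))
    (h : ∀ r P, 1 - δ ≤ (alg r).probRegretLE s₁ r P β) :
    N * (1 - 2 * δ - 2 * η) ≤ M := by
  obtain ⟨H, rfl⟩ := Nat.exists_eq_add_of_le' hH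
  have : Nontrivial (Fin S) := Fin.nontrivial_iff_two_le.2 hS
  have : Nontrivial (Fin A) := Fin.nontrivial_iff_two_le.2 hA
  obtain ⟨b, hb⟩ := exists_ne s₁
  obtain ⟨a₁, a₂, ha⟩ := exists_pair_ne (Fin A)
  have hK1 : (1 : ℝ) ≤ K := by exact_mod_cast hK
  have hK0 : (0 : ℝ) < K := by linarith
  have hsK : 0 < √(K : ℝ) := Real.sqrt_pos.2 hK0
  -- The solution of `u (j + 1) = G * √K * √(u j)` with `u 0 = G ^ 2`; `hN` says exactly that `u N ≤
  -- K`.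
  let u : ℕ → ℝ := fun j => G ^ 2 * (K : ℝ) ^ (1 - (1 / 2 : ℝ) ^ j)
  have hmono : Monotone u := fun i j hij => by
    refine mul_le_mul_of_nonneg_left (Real.rpow_le_rpow_of_exponent_le hK1 ?_) (sq_nonneg G)
    have := pow_le_pow_of_le_one (by norm_num : (0 : ℝ) ≤ 1 / 2) (by norm_num) hij
    linarith
  have hu1 : ∀ j, 1 ≤ u j := fun j => by
    refine le_trans ?_ (hmono (Nat.zero_le j))
    simp only [u, pow_zero, sub_self, Real.rpow_zero, mul_one]
    nlinarith
  have huN : u N ≤ K := by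
    calc u N ≤ (K : ℝ) ^ ((1 / 2 : ℝ) ^ N) * (K : ℝ) ^ (1 - (1 / 2 : ℝ) ^ N) :=
          mul_le_mul_of_nonneg_right hN (by positivity)
      _ = K := by
          rw [← Real.rpow_add hK0]
          simp
  have hsqrt : ∀ j, √(u j) = G * (K : ℝ) ^ ((1 - (1 / 2 : ℝ) ^ j) / 2) := by
    intro j
    rw [Real.sqrt_eq_iff_mul_self_eq (by positivity) (by positivity)]
    have : (K : ℝ) ^ ((1 - (1 / 2 : ℝ) ^ j) / 2) * (K : ℝ) ^ ((1 - (1 / 2 : ℝ) ^ j) / 2) =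
        (K : ℝ) ^ (1 - (1 / 2 : ℝ) ^ j) := by
      rw [← Real.rpow_add hK0, add_halves]
    simp only [u, ← this]
    ring
  have hsucc : ∀ j, u (j + 1) = G * √K * √(u j) := by
    intro j
    have : (K : ℝ) ^ (1 - (1 / 2 : ℝ) ^ (j + 1)) =
        (K : ℝ) ^ (1 / 2 : ℝ) * (K : ℝ) ^ ((1 - (1 / 2 : ℝ) ^ j) / 2) := by
      rw [← Real.rpow_add hK0]
      congr 1
      ring
    rw [hsqrt, Real.sqrt_eq_rpow]
    simp only [u, this]
    ring
  refine (alg (stepReward s₁ 1)).levels_le_of_probRegretLE hb ha.symm hK hη hη' (by linarith) hu1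
    hmono huN (fun j hj => ?_) (h _)
  have hs1 : 0 < √(u j) := Real.sqrt_pos.2 (lt_of_lt_of_le one_pos (hu1 j))
  have hs2 : √(u j) ≤ √K := Real.sqrt_le_sqrt ((hmono hj.le).trans huN)
  have hs3 : √(u j) * √(u j) = u j := Real.mul_self_sqrt (le_trans zero_le_one (hu1 j))
  have h1 : 6 * β < η * (G * √K - √(u j)) := by
    have h2 := mul_lt_mul_of_pos_right hG hsK
    have h3 := mul_le_mul_of_nonneg_left hs2 hη.le
    linarith
  rw [hsucc]
  calc 6 * β * √(u j) < η * (G * √K - √(u j)) * √(u j) := mul_lt_mul_of_pos_right h1 hs1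
    _ = _ := by linear_combination -η * hs3

/-- The number of levels in the iterated-logarithm bound. -/
theorem exists_levels {ε : ℝ} (hε : 0 < ε) {Λ Y q : ℝ} {B : ℝ} (hY : 1 ≤ Y) (hq : 0 ≤ q)
    (hB1 : q ^ (1 + ε) ≤ B) (hB2 : (2 : ℝ) ^ (2 / (ε / (1 + ε))) ≤ B)
    (h : B * Y ^ (1 + ε) ≤ Λ) :
    ∃ N : ℕ, q * Y * 2 ^ N ≤ Λ ∧ ε / (1 + ε) / 2 * Real.logb 2 Λ ≤ N ∧ 1 ≤ Real.logb 2 Λ := by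
  set θ := ε / (1 + ε) with hθ
  have hε1 : 0 < 1 + ε := by linarith
  have hθ0 : 0 < θ := by positivity
  have hθ1 : θ ≤ 1 := by
    rw [hθ, div_le_one hε1]
    linarith
  have hY1 : 1 ≤ Y ^ (1 + ε) := Real.one_le_rpow hY hε1.le
  have hB0 : 0 < B := lt_of_lt_of_le (by positivity) hB2
  have hBΛ : B ≤ Λ := le_trans (by nlinarith) h
  have hΛ0 : 0 < Λ := hB0.trans_le hBΛ
  have hlog : 2 / θ ≤ Real.logb 2 Λ := by
    rw [Real.le_logb_iff_rpow_le one_lt_two hΛ0]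
    exact hB2.trans hBΛ
  have hlog2 : 2 ≤ θ * Real.logb 2 Λ := by
    rw [div_le_iff₀ hθ0] at hlog
    linarith
  have hlog1 : 1 ≤ Real.logb 2 Λ := by
    refine le_trans ?_ hlog
    rw [le_div_iff₀ hθ0]
    linarith
  -- Here `2 ^ N ≤ Λ ^ θ` and `q * Y ≤ Λ ^ (1 / (1 + ε))`, with exponents summing to 1. Since `θ *
  -- Real.logb 2 Λ ≥ 2`, the floor loses at most half.
  refine ⟨⌊θ * Real.logb 2 Λ⌋₊, ?_, ?_, hlog1⟩
  · have h1 : (2 : ℝ) ^ ⌊θ * Real.logb 2 Λ⌋₊ ≤ Λ ^ θ := by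
      rw [← Real.rpow_natCast]
      calc (2 : ℝ) ^ ((⌊θ * Real.logb 2 Λ⌋₊ : ℕ) : ℝ) ≤ (2 : ℝ) ^ (θ * Real.logb 2 Λ) :=
            Real.rpow_le_rpow_of_exponent_le one_le_two (Nat.floor_le (by linarith))
        _ = Λ ^ θ := by
            rw [mul_comm, Real.rpow_mul two_pos.le, Real.rpow_logb two_pos (by norm_num) hΛ0]
    have h2 : q * Y ≤ Λ ^ (1 / (1 + ε)) := by
      have h3 : (q * Y) ^ (1 + ε) ≤ Λ := by
        rw [Real.mul_rpow hq (by linarith)]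
        exact (mul_le_mul_of_nonneg_right hB1 (by linarith)).trans h
      calc q * Y = ((q * Y) ^ (1 + ε)) ^ (1 / (1 + ε)) := by
            rw [← Real.rpow_mul (by positivity), mul_one_div_cancel hε1.ne', Real.rpow_one]
        _ ≤ Λ ^ (1 / (1 + ε)) := Real.rpow_le_rpow (by positivity) h3 (by positivity)
    calc q * Y * 2 ^ ⌊θ * Real.logb 2 Λ⌋₊ ≤ Λ ^ (1 / (1 + ε)) * Λ ^ θ :=
          mul_le_mul h2 h1 (by positivity) (by positivity)
      _ = Λ := by
          rw [← Real.rpow_add hΛ0, hθ, ← add_div, div_self hε1.ne', Real.rpow_one]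
  · have := (Nat.lt_floor_add_one (θ * Real.logb 2 Λ)).le
    linarith

/-- The two sides differ through `-log₂ (ln 2) ≤ 1`, which `h` absorbs. -/
theorem logb_logb_le {k : ℝ} (h : 1 ≤ Real.logb 2 (Real.log k)) :
    Real.logb 2 (Real.logb 2 k) ≤ 2 * Real.logb 2 (Real.log k) := by
  have hk : Real.log k ≠ 0 := fun h0 => by
    rw [h0, Real.logb_zero] at h
    linarith
  have hl : 0 < Real.log 2 := Real.log_pos one_lt_two
  have h1 : Real.logb 2 (Real.log 2) ≥ -1 := by
    rw [ge_iff_le, Real.le_logb_iff_rpow_le one_lt_two hl, Real.rpow_neg_one]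
    linarith [Real.log_two_gt_d9]
  conv_lhs => rw [Real.logb, Real.logb, Real.log_div hk hl.ne', sub_div]
  rw [Real.logb] at h1 h ⊢
  linarith

/-- Both modes of the regret bound give a bound with probability at least `1 - δ`. -/
theorem exists_probRegretLE {s₁ : Fin S} (alg : Reward S A H → BatchAlgorithm.{u} S A H K M)
    {C X δ : ℝ} (hδ : 0 < δ) (hδ1 : δ < 1) (hX : 0 < X) (hK : 0 < K)
    (h : (∀ r P, 1 - δ ≤ (alg r).probRegretLE s₁ r P (C * X * √K)) ∨
      (∀ r P, (alg r).expectedRegret s₁ r P ≤ C * X * √K)) :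
    ∃ β ≤ max C 1 / δ * X * √K, ∀ r P, 1 - δ ≤ (alg r).probRegretLE s₁ r P β := by
  have hsK : 0 < √(K : ℝ) := Real.sqrt_pos.2 (by exact_mod_cast hK)
  -- `max C 1` is positive even if `C` is not, as Markov's inequality needs here; the later division
  -- by `δ` is its loss.
  have h1 : C * X * √K ≤ max C 1 * X * √K := by
    gcongr
    exact le_max_left _ _
  have hm : 0 < max C 1 := lt_of_lt_of_le one_pos (le_max_right _ _)
  rcases h with h | h
  · refine ⟨_, h1.trans ?_, h⟩
    gcongr
    rw [le_div_iff₀ hδ]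
    nlinarith
  · refine ⟨max C 1 * X * √K / δ, le_of_eq (by ring), fun r P => ?_⟩
    exact (alg r).one_sub_le_probRegretLE s₁ r P hK hδ (by positivity) ((h r P).trans h1)

end BatchBounds

/-- Lower bound on the number of batches.  The reward function is known to the algorithm, so an
algorithm is a family indexed by the reward function; the transition model is unknown.  The regret
bound `C (S A H)^p √K` holds in every MDP, either with probability at least `1 - δ` or in
expectation.  The constant `c` does not depend on the polynomial. -/
theorem theorem2 (δ ε : ℝ) (hδ₀ : 0 < δ) (hδ : δ < 1 / 2) (hε : 0 < ε) :
    ∃ c : ℝ, 0 < c ∧ ∀ (C : ℝ) (p : ℕ), ∃ B : ℕ,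
      ∀ (S A H K M : ℕ), 2 ≤ S → 2 ≤ A → 2 ≤ H →
      ∀ (s₁ : Fin S) (alg : Reward S A H → BatchAlgorithm.{u} S A H K M),
        ((∀ (r : Reward S A H) (P : Transition S A H),
            1 - δ ≤ (alg r).probRegretLE s₁ r P
              (C * ((S : ℝ) * A * H) ^ p * Real.sqrt K)) ∨
          (∀ (r : Reward S A H) (P : Transition S A H),
            (alg r).expectedRegret s₁ r P ≤ C * ((S : ℝ) * A * H) ^ p * Real.sqrt K)) →
        ((B * (S * A * H)) ^ B ≤ K → c * (H / Real.logb A K) ≤ M) ∧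
        (B * Real.log ((S : ℝ) * A * H) ^ (1 + ε) ≤ Real.log K →
          c * (H / Real.logb A K + Real.logb 2 (Real.logb 2 K)) ≤ M) := by
  set θ := ε / (1 + ε) with hθ
  have hθ0 : 0 < θ := by positivity
  -- The factors are `θ / 2` from the number of levels, `(1 - 2 * δ) / 2` from each level, and 1/2
  -- from `logb_logb_le`.
  set c₂ := θ * (1 - 2 * δ) / 8 with hc₂
  have hδ2 : 0 < 1 - 2 * δ := by linarith
  have hc₂0 : 0 < c₂ := by positivity
  -- The two lower bounds on `M` are averaged, hence the division by 2.
  refine ⟨min (1 / 3) c₂ / 2, by positivity, fun C p => ?_⟩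
  set η := (1 - 2 * δ) / 4 with hη
  have hη0 : 0 < η := by positivity
  set Γ := max C 1 / δ with hΓ
  have hΓ0 : 0 < Γ := by positivity
  -- As `n = S * A * H ≥ 2`, the constant in `G` is at most `n ^ j`, which gives `G ≤ n ^ p'`.
  obtain ⟨j, hj⟩ := pow_unbounded_of_one_lt (2 + 6 * Γ / η) one_lt_two
  set p' := p + j with hp'
  obtain ⟨B, hB⟩ := exists_nat_ge (max ((2 * p' + 2 : ℝ) ^ (1 + ε)) ((2 : ℝ) ^ (2 / θ)))
  have hB1 : (2 * p' + 2 : ℝ) ^ (1 + ε) ≤ B := (le_max_left _ _).trans hB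
  have hB2 : (2 : ℝ) ^ (2 / θ) ≤ B := (le_max_right _ _).trans hB
  have hBp : (2 * p' + 2 : ℝ) ≤ B := by
    refine le_trans ?_ hB1
    have h1 : (1 : ℝ) ≤ 2 * p' + 2 := by
      have : (0 : ℝ) ≤ p' := Nat.cast_nonneg _
      linarith
    calc (2 * p' + 2 : ℝ) = (2 * p' + 2 : ℝ) ^ (1 : ℝ) := (Real.rpow_one _).symm
      _ ≤ _ := Real.rpow_le_rpow_of_exponent_le h1 (by linarith)
  have hBp' : 2 * p' + 2 ≤ B := by exact_mod_cast hBp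
  refine ⟨B, fun S A H K M hS hA hH s₁ alg halg => ?_⟩
  set n := S * A * H with hn
  have hn8 : 8 ≤ n := by
    calc 8 = 2 * 2 * 2 := by norm_num
      _ ≤ S * A * H := Nat.mul_le_mul (Nat.mul_le_mul hS hA) hH
  have hAn : A ≤ n := by
    calc A = 1 * A * 1 := by ring
      _ ≤ S * A * H := Nat.mul_le_mul (Nat.mul_le_mul (by omega) le_rfl) (by omega)
  have hX : (S : ℝ) * A * H = n := by simp [hn]
  rw [hX] at halg ⊢
  have hX8 : (8 : ℝ) ≤ n := by exact_mod_cast hn8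
  have hX0 : (0 : ℝ) < n := by linarith
  set G := (2 + 6 * Γ / η) * (n : ℝ) ^ p with hG
  have hnp : 1 ≤ (n : ℝ) ^ p := one_le_pow₀ (by linarith)
  have hΓη : 0 < 6 * Γ / η := by positivity
  have hGX : G ≤ (n : ℝ) ^ p' := by
    rw [hG, hp', pow_add, mul_comm]
    refine mul_le_mul_of_nonneg_left (hj.le.trans ?_) (by positivity)
    exact pow_le_pow_left₀ two_pos.le (by linarith) j
  have hG1 : 1 ≤ G := by nlinarith
  have hGΓ : η + 6 * (Γ * (n : ℝ) ^ p) < η * G := by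
    have : η * G = 2 * η * (n : ℝ) ^ p + 6 * (Γ * (n : ℝ) ^ p) := by
      rw [hG]
      field_simp
    nlinarith
  have hsecond : n ^ (2 * p' + 2) ≤ K → 0 < K ∧
      1 / 3 * (H / Real.logb A K) ≤ M ∧ ∃ β ≤ Γ * (n : ℝ) ^ p * √K,
        ∀ r P, 1 - δ ≤ (alg r).probRegretLE s₁ r P β := by
    intro hKn
    have hnK : n ≤ K := le_trans (Nat.le_self_pow (by omega) n) hKn
    have hK0 : 0 < K := by omega
    obtain ⟨β, hβ, hprob⟩ := exists_probRegretLE alg hδ₀ (by linarith) (by positivity) hK0 halg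
    refine ⟨hK0, horizon_div_log_le alg hS hA hH (hAn.trans hnK) (by omega) ?_ hδ hprob,
      β, hβ, hprob⟩
    have hsK : 0 < √(K : ℝ) := Real.sqrt_pos.2 (by exact_mod_cast hK0)
    have h1 : (n : ℝ) ^ p' ≤ √K := by
      refine Real.le_sqrt_of_sq_le ?_
      rw [← pow_mul]
      have h2 : n ^ (p' * 2) ≤ K :=
        (Nat.pow_le_pow_right (by omega) (by omega)).trans hKn
      exact_mod_cast h2
    have h2 : 2 * (Γ * (n : ℝ) ^ p) < G := by
      have h3 : 0 < Γ * (n : ℝ) ^ p := by positivity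
      have hη1 : η ≤ 1 / 4 := by rw [hη]; linarith
      by_contra hcon
      push Not at hcon
      nlinarith
    calc 2 * β ≤ 2 * (Γ * (n : ℝ) ^ p) * √K := by linarith
      _ < √K * √K := mul_lt_mul_of_pos_right (h2.trans_le (hGX.trans h1)) hsK
      _ = K := Real.mul_self_sqrt (Nat.cast_nonneg _)
  have hlogb : 0 < K → 0 ≤ (H : ℝ) / Real.logb A K := fun hK0 => by
    refine div_nonneg (Nat.cast_nonneg _) (Real.logb_nonneg ?_ ?_)
    · exact_mod_cast hA
    · exact_mod_cast hK0
  refine ⟨fun hK => ?_, fun hK => ?_⟩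
  · have hKn : n ^ (2 * p' + 2) ≤ K := by
      refine le_trans ?_ hK
      calc n ^ (2 * p' + 2) ≤ n ^ B := Nat.pow_le_pow_right (by omega) hBp'
        _ ≤ (B * n) ^ B := Nat.pow_le_pow_left (Nat.le_mul_of_pos_left n (by omega)) B
    obtain ⟨hK0, h1, -⟩ := hsecond hKn
    refine le_trans (mul_le_mul_of_nonneg_right ?_ (hlogb hK0)) h1
    have := min_le_left (1 / 3) c₂
    linarith
  · have hY : 1 ≤ Real.log n := by
      rw [Real.le_log_iff_exp_le hX0]
      linarith [Real.exp_one_lt_d9]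
    have hY' : Real.log n ≤ Real.log n ^ (1 + ε) := by
      calc Real.log n = Real.log n ^ (1 : ℝ) := (Real.rpow_one _).symm
        _ ≤ _ := Real.rpow_le_rpow_of_exponent_le hY (by linarith)
    have hlogK : (2 * p' + 2 : ℝ) * Real.log n ≤ Real.log K :=
      (mul_le_mul hBp hY' (by linarith) (Nat.cast_nonneg _)).trans hK
    have hK0' : K ≠ 0 := by
      rintro rfl
      have : 0 < (2 * p' + 2 : ℝ) * Real.log n := by positivity
      simp at hlogK
      linarith
    have hKpos : (0 : ℝ) < K := by positivity
    have hKn : n ^ (2 * p' + 2) ≤ K := by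
      have : (n : ℝ) ^ (2 * p' + 2) ≤ K := by
        rw [← Real.log_le_log_iff (by positivity) hKpos, Real.log_pow]
        push_cast
        exact hlogK
      exact_mod_cast this
    obtain ⟨hK0, h1, β, hβ, hprob⟩ := hsecond hKn
    obtain ⟨N, hN1, hN2, hN3⟩ := exists_levels hε (q := 2 * p' + 2) hY (by positivity) hB1 hB2 hK
    have hNG : G ^ 2 ≤ (K : ℝ) ^ ((1 / 2 : ℝ) ^ N) := by
      rw [← Real.log_le_log_iff (by positivity) (by positivity), Real.log_pow,
        Real.log_rpow hKpos, one_div, inv_pow, inv_mul_eq_div, le_div_iff₀ (by positivity)]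
      have h2 : Real.log G ≤ p' * Real.log n := by
        rw [← Real.log_pow]
        exact Real.log_le_log (by linarith) hGX
      push_cast
      refine le_trans (mul_le_mul_of_nonneg_right ?_ (by positivity)) hN1
      linarith
    have h2 := levels_le_batches alg hS hA hH hK0 hη0 (by rw [hη]; linarith) hδ hβ hG1 hGΓ hNG
      hprob
    have h3 := logb_logb_le hN3
    have h4 : c₂ * Real.logb 2 (Real.logb 2 K) ≤ M := by
      refine le_trans ?_ h2
      have h5 : 1 - 2 * δ - 2 * η = (1 - 2 * δ) / 2 := by rw [hη]; ring
      rw [h5]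
      calc c₂ * Real.logb 2 (Real.logb 2 K) ≤ c₂ * (2 * Real.logb 2 (Real.log K)) :=
            mul_le_mul_of_nonneg_left h3 hc₂0.le
        _ = θ / 2 * Real.logb 2 (Real.log K) * ((1 - 2 * δ) / 2) := by
            rw [hc₂]
            ring
        _ ≤ N * ((1 - 2 * δ) / 2) := mul_le_mul_of_nonneg_right hN2 (by positivity)
    have h6 : 0 ≤ Real.logb 2 (Real.logb 2 K) := by
      refine Real.logb_nonneg one_lt_two ?_
      rw [Real.le_logb_iff_rpow_le one_lt_two hKpos, Real.rpow_one]
      have : n ≤ K := le_trans (Nat.le_self_pow (by omega) n) hKn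
      exact_mod_cast (by omega : 2 ≤ K)
    have h7 := mul_le_mul_of_nonneg_right (min_le_left (1 / 3) c₂) (hlogb hK0)
    have h8 := mul_le_mul_of_nonneg_right (min_le_right (1 / 3) c₂) h6
    linarith
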